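/- Let $\mathbb{K}$ be $\mathbb{R}$ or $\mathbb{C}$, and let $(M,c)$ be an oriented conformal $4$-manifold over $\mathbb{K}$: a smooth oriented manifold with a conformal class of Riemannian metrics if $\mathbb{K}=\mathbb{R}$; a complex manifold with a holomorphic conformal structure (represented locally by holomorphic, nondegenerate, symmetric complex-bilinear forms on $TM$, up to nowhere zero holomorphic factors) and with a choice of one of the two compatible Hodge operators on $\Lambda^2 M$ if $\mathbb{K}=\mathbb{C}$. Suppose that $(M,c)$ is self-dual, i.e. $W^-=0$. Let $Q\to M$ be an (immersed) hypersurface on which $c$ induces a nondegenerate conformal structure, and suppose that $Q$ is umbilic, i.e. that, for the local metrics of $c$, its second fundamental form is, in each normal direction, proportional to the induced metric. Then: (i) The Weyl tensor of $M$ vanishes at every point of $Q$. (ii) Let $x\in Q$, let $g$ be any local metric of the class $c$ around $x$, let $\nabla$ be its Levi-Civita connection, and let $\nu\perp T_xQ$ with $g(\nu,\nu)=1$. Then, for all $A,B\in\Lambda^2_xQ$, $$g\big((\nabla_\nu W^+)(A),B\big)_x=-\,C(A)(*_Q B)_x .$$ Here $\Lambda^2_xQ\subset\Lambda^2T_xM$;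 the curvature is $R(X,Y)=\nabla_{[X,Y]}-[\nabla_X,\nabla_Y]$ and $g(W(X\wedge Y),Z\wedge T)=g(W(X,Y)Z,T)$ (so $g(R(X,Y)X,Y)>0$ on round spheres); $W=R-h\wedge I$ with $(h\wedge I)(X,Y)=h(X)\wedge Y-h(Y)\wedge X$ and $(a\wedge b)(Z)=g(a,Z)b-g(b,Z)a$, where in dimension $n$ the normalized Ricci tensor is $h=\frac{1}{2n(n-1)}\mathrm{Scal}\cdot g+\frac1{n-2}\mathrm{Ric}_0$; $W^\pm=\frac12(W\pm W\circ *)$; $C(X\wedge Y)(Z)=(\nabla^Q_Xh^Q)(Y,Z)-(\nabla^Q_Yh^Q)(X,Z)$ is the Cotton–York tensor of the metric induced by $g$ on $Q$; and $*_Q:\Lambda^2_xQ\to T_xQ$ is the Hodge operator of the induced metric and of the orientation of $T_xQ$ for which $(X,Y,Z)$ is positive if and only if $(X,Y,Z,\nu)$ is positive in $T_xM$. -/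

import Mathlib

open scoped Manifold ContDiff Topology

noncomputable section

namespace UmbilicHypersurface

/-- The coordinate space `𝕜ⁿ`. Only its structure of a finite-dimensional normed space matters. -/
abbrev Coord (𝕜 : Type*) [RCLike 𝕜] (n : ℕ) : Type _ := EuclideanSpace 𝕜 (Fin n)

/-- Continuous bilinear forms on `E`; over `ℂ` these are complex-bilinear (not sesquilinear). -/
abbrev Bil (𝕜 : Type*) [RCLike 𝕜] (E : Type*) [NormedAddCommGroup E] [NormedSpace 𝕜 E] : Type _ :=
  E →L[𝕜] E →L[𝕜] 𝕜

/-! ### Tensor calculus of a metric on an open subset of coordinate space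

A metric is a function `g` from points of `𝕜ⁿ` to bilinear forms on `𝕜ⁿ`; it is only used near
points at which it is smooth and nondegenerate. -/

section Coordinates

variable {𝕜 : Type*} [RCLike 𝕜] {n : ℕ}

/-- The coordinate vector `∂ᵢ`. -/
def coordVec (𝕜 : Type*) [RCLike 𝕜] {n : ℕ} (i : Fin n) : Coord 𝕜 n :=
  EuclideanSpace.single i 1

/-- The vector `(dxⁱ)♯`, determined by `β ((dxⁱ)♯) v = vⁱ` for all `v`
(when `β` is nondegenerate). -/
def dualVec (β : Bil 𝕜 (Coord 𝕜 n)) (i : Fin n) : Coord 𝕜 n :=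
  β.inverse (EuclideanSpace.proj i)

/-- The Levi-Civita connection of `g` on coordinate vector fields:
`2 g(Γ(u,v), w) = ∂ᵤ g(v,w) + ∂ᵥ g(u,w) - ∂_w g(u,v)`. -/
def christoffel (g : Coord 𝕜 n → Bil 𝕜 (Coord 𝕜 n)) (x u v : Coord 𝕜 n) : Coord 𝕜 n :=
  (g x).inverse ((2 : 𝕜)⁻¹ • (fderiv 𝕜 g x u v + fderiv 𝕜 g x v u
    - ((fderiv 𝕜 g x).flip u).flip v))

/-- The Riemannian curvature `R(u,v)w`, with the sign convention
`R(u,v) = ∇_[u,v] - [∇ᵤ, ∇ᵥ]`, for which `g(R(u,v)u, v)` is positive on round spheres. -/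
def riemann (g : Coord 𝕜 n → Bil 𝕜 (Coord 𝕜 n)) (x u v w : Coord 𝕜 n) : Coord 𝕜 n :=
  -(fderiv 𝕜 (fun y => christoffel g y v w) x u - fderiv 𝕜 (fun y => christoffel g y u w) x v
    + christoffel g x u (christoffel g x v w) - christoffel g x v (christoffel g x u w))

/-- The Ricci tensor `Ric(u,v) = tr (w ↦ R(u,w)v)`. -/
def ricci (g : Coord 𝕜 n → Bil 𝕜 (Coord 𝕜 n)) (x u v : Coord 𝕜 n) : 𝕜 :=
  ∑ i, (riemann g x u (coordVec 𝕜 i) v) i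

/-- The scalar curvature, the trace of `Ric` with respect to `g`. -/
def scal (g : Coord 𝕜 n → Bil 𝕜 (Coord 𝕜 n)) (x : Coord 𝕜 n) : 𝕜 :=
  ∑ i, ricci g x (coordVec 𝕜 i) (dualVec (g x) i)

/-- The normalized Ricci tensor `h = Scal / (2n(n-1)) g + 1 / (n-2) Ric₀`, where
`Ric₀ = Ric - (Scal / n) g`. -/
def normRicci (g : Coord 𝕜 n → Bil 𝕜 (Coord 𝕜 n)) (x u v : Coord 𝕜 n) : 𝕜 :=
  scal g x / (2 * (n : 𝕜) * ((n : 𝕜) - 1)) * g x u v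
    + 1 / ((n : 𝕜) - 2) * (ricci g x u v - scal g x / (n : 𝕜) * g x u v)

/-- The Weyl tensor `W(u,v,w,t) = g(W(u,v)w, t)`, where `W = R - h ∧ I`,
`(h ∧ I)(u,v) = h(u) ∧ v - h(v) ∧ u` and `(a ∧ b)(w) = g(a,w) b - g(b,w) a`. -/
def weyl (g : Coord 𝕜 n → Bil 𝕜 (Coord 𝕜 n)) (x u v w t : Coord 𝕜 n) : 𝕜 :=
  g x (riemann g x u v w) t
    - (normRicci g x u w * g x v t - g x v w * normRicci g x u t
      - (normRicci g x v w * g x u t - g x u w * normRicci g x v t))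

/-- The Cotton–York tensor `C(u,v)(w) = (∇ᵤ h)(v,w) - (∇ᵥ h)(u,w)`. -/
def cotton (g : Coord 𝕜 n → Bil 𝕜 (Coord 𝕜 n)) (x u v w : Coord 𝕜 n) : 𝕜 :=
  (fderiv 𝕜 (fun y => normRicci g y v w) x u
      - normRicci g x (christoffel g x u v) w - normRicci g x v (christoffel g x u w))
    - (fderiv 𝕜 (fun y => normRicci g y u w) x v
      - normRicci g x (christoffel g x v u) w - normRicci g x u (christoffel g x v w))

/-- The composition `W ∘ *` of the Weyl tensor with the Hodge operator of `Λ²` given by `g` and the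
volume form `vol`: `*(u ∧ v) = 1/2 ∑ vol(u, v, ∂ᵢ, ∂ⱼ) (dxⁱ)♯ ∧ (dxʲ)♯`, so that
`*(e₁ ∧ e₂) = e₃ ∧ e₄` for every orthonormal basis with `vol(e₁, e₂, e₃, e₄) = 1`. -/
def weylStar (g : Coord 𝕜 4 → Bil 𝕜 (Coord 𝕜 4)) (vol : Coord 𝕜 4 → Coord 𝕜 4 [⋀^Fin 4]→L[𝕜] 𝕜)
    (x u v w t : Coord 𝕜 4) : 𝕜 :=
  1 / 2 * ∑ i, ∑ j, vol x ![u, v, coordVec 𝕜 i, coordVec 𝕜 j]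
    * weyl g x (dualVec (g x) i) (dualVec (g x) j) w t

/-- The self-dual Weyl tensor `W⁺ = 1/2 (W + W ∘ *)`. -/
def weylPlus (g : Coord 𝕜 4 → Bil 𝕜 (Coord 𝕜 4)) (vol : Coord 𝕜 4 → Coord 𝕜 4 [⋀^Fin 4]→L[𝕜] 𝕜)
    (x u v w t : Coord 𝕜 4) : 𝕜 :=
  1 / 2 * (weyl g x u v w t + weylStar g vol x u v w t)

/-- The anti-self-dual Weyl tensor `W⁻ = 1/2 (W - W ∘ *)`. -/
def weylMinus (g : Coord 𝕜 4 → Bil 𝕜 (Coord 𝕜 4)) (vol : Coord 𝕜 4 → Coord 𝕜 4 [⋀^Fin 4]→L[𝕜] 𝕜)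
    (x u v w t : Coord 𝕜 4) : 𝕜 :=
  1 / 2 * (weyl g x u v w t - weylStar g vol x u v w t)

/-- The covariant derivative `(∇ₘ T)(u,v,w,t)` of a covariant `4`-tensor field `T` with respect to
the Levi-Civita connection of `g`. -/
def covDeriv (g : Coord 𝕜 n → Bil 𝕜 (Coord 𝕜 n))
    (T : Coord 𝕜 n → Coord 𝕜 n → Coord 𝕜 n → Coord 𝕜 n → Coord 𝕜 n → 𝕜)
    (x m u v w t : Coord 𝕜 n) : 𝕜 :=
  fderiv 𝕜 (fun y => T y u v w t) x m
    - T x (christoffel g x m u) v w t - T x u (christoffel g x m v) w t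
    - T x u v (christoffel g x m w) t - T x u v w (christoffel g x m t)

/-- The second fundamental form, in the direction of a normal vector `ν`, of a map `F` into the
open subset of `𝕜ⁿ` with metric `g`: `II_ν(X, Y) = g(∂_X ∂_Y F + Γ(∂_X F, ∂_Y F), ν)`, which is
`g(∇_X Y, ν)`. -/
def secondFundamentalForm {m : ℕ} (g : Coord 𝕜 n → Bil 𝕜 (Coord 𝕜 n)) (F : Coord 𝕜 m → Coord 𝕜 n)
    (p : Coord 𝕜 m) (ν : Coord 𝕜 n) (X Y : Coord 𝕜 m) : 𝕜 :=
  g (F p) (fderiv 𝕜 (fun y => fderiv 𝕜 F y Y) p X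
    + christoffel g (F p) (fderiv 𝕜 F p X) (fderiv 𝕜 F p Y)) ν

end Coordinates

/-! ### Tensor fields on manifolds and their coordinate expressions -/

section Manifolds

variable {𝕜 : Type*} [RCLike 𝕜] {n : ℕ}

/-- Bilinear forms on the tangent space `T_x M`. -/
abbrev TBil (𝕜 : Type*) [RCLike 𝕜] (n : ℕ) {M : Type*} [TopologicalSpace M]
    [ChartedSpace (Coord 𝕜 n) M] (x : M) : Type _ :=
  TangentSpace 𝓘(𝕜, Coord 𝕜 n) x →L[𝕜] TangentSpace 𝓘(𝕜, Coord 𝕜 n) x →L[𝕜] 𝕜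

/-- Alternating `4`-forms on the tangent space `T_x M`. -/
abbrev TVol (𝕜 : Type*) [RCLike 𝕜] (n : ℕ) {M : Type*} [TopologicalSpace M]
    [ChartedSpace (Coord 𝕜 n) M] (x : M) : Type _ :=
  TangentSpace 𝓘(𝕜, Coord 𝕜 n) x [⋀^Fin 4]→L[𝕜] 𝕜

variable {M : Type*} [TopologicalSpace M] [ChartedSpace (Coord 𝕜 n) M]

/-- The pull-back `f^* g` of a field of bilinear forms by a map `f : N → M`. -/
def pullback {m : ℕ} {N : Type*} [TopologicalSpace N] [ChartedSpace (Coord 𝕜 m) N]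
    (f : N → M) (g : ∀ x : M, TBil 𝕜 n x) (q : N) : TBil 𝕜 m q :=
  (ContinuousLinearMap.precomp 𝕜 (mfderiv 𝓘(𝕜, Coord 𝕜 m) 𝓘(𝕜, Coord 𝕜 n) f q)).comp
    ((g (f q)).comp (mfderiv 𝓘(𝕜, Coord 𝕜 m) 𝓘(𝕜, Coord 𝕜 n) f q))

/-- The expression of a field of bilinear forms in the chart `φ`. -/
def bilInChart (φ : OpenPartialHomeomorph M (Coord 𝕜 n)) (g : ∀ x : M, TBil 𝕜 n x) :
    Coord 𝕜 n → Bil 𝕜 (Coord 𝕜 n) :=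
  fun p => pullback (φ.symm : Coord 𝕜 n → M) g p

/-- The expression of a `4`-form in the chart `φ`. -/
def volInChart (φ : OpenPartialHomeomorph M (Coord 𝕜 n)) (vol : ∀ x : M, TVol 𝕜 n x) :
    Coord 𝕜 n → Coord 𝕜 n [⋀^Fin 4]→L[𝕜] 𝕜 :=
  fun p => (vol (φ.symm p)).compContinuousLinearMap
    (mfderiv 𝓘(𝕜, Coord 𝕜 n) 𝓘(𝕜, Coord 𝕜 n) (φ.symm : Coord 𝕜 n → M) p)

/-- The components in the chart `φ` of a tangent vector at `x`. -/
def vecInChart (φ : OpenPartialHomeomorph M (Coord 𝕜 n)) (x : M)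
    (v : TangentSpace 𝓘(𝕜, Coord 𝕜 n) x) : Coord 𝕜 n :=
  mfderiv 𝓘(𝕜, Coord 𝕜 n) 𝓘(𝕜, Coord 𝕜 n) (φ : M → Coord 𝕜 n) x v

/-- `g` is a (complex-)Riemannian metric on the open set `U`: a smooth (for `𝕜 = ℂ`: holomorphic)
field of symmetric bilinear forms such that every tangent space has an orthonormal basis. By linear
algebra the last condition means that `g` is positive definite if `𝕜 = ℝ`, and that it is
nondegenerate if `𝕜 = ℂ`. -/
structure IsMetricOn (U : Set M) (g : ∀ x : M, TBil 𝕜 n x) : Prop where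
  symm : ∀ x ∈ U, ∀ u v, g x u v = g x v u
  exists_orthonormal : ∀ x ∈ U, ∃ b : Fin n → TangentSpace 𝓘(𝕜, Coord 𝕜 n) x,
    ∀ i j, g x (b i) (b j) = if i = j then 1 else 0
  smooth : ∀ φ ∈ atlas (Coord 𝕜 n) M,
    ContDiffOn 𝕜 ∞ (bilInChart φ g) (φ.target ∩ φ.symm ⁻¹' U)

end Manifolds

/-! ### Oriented conformal structures in dimension four -/

section Conformal

variable {𝕜 : Type*} [RCLike 𝕜] {M : Type*} [TopologicalSpace M] [ChartedSpace (Coord 𝕜 4) M]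

/-- `vol` is a smooth (holomorphic) volume form on `U` of norm one for `g`: it takes the values `1`
and `-1` on `g`-orthonormal bases. -/
structure IsVolumeOn (U : Set M) (g : ∀ x : M, TBil 𝕜 4 x) (vol : ∀ x : M, TVol 𝕜 4 x) : Prop where
  norm_one : ∀ x ∈ U, ∀ b : Fin 4 → TangentSpace 𝓘(𝕜, Coord 𝕜 4) x,
    (∀ i j, g x (b i) (b j) = if i = j then 1 else 0) → vol x b ^ 2 = 1
  smooth : ∀ φ ∈ atlas (Coord 𝕜 4) M,
    ContDiffOn 𝕜 ∞ (volInChart φ vol) (φ.target ∩ φ.symm ⁻¹' U)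

/-- An oriented conformal structure on a `4`-manifold. At each point it is a class of pairs
`(g, vol)`, a metric with a volume form, up to `(g, vol) ∼ (f g, f² vol)` with a nonzero scalar `f`;
locally the class is that of a smooth (holomorphic) metric with a smooth volume form of norm one.
There is no global metric in the class in general. (For `𝕜 = ℝ` the factors `f` that occur
between metrics of the class are positive, as metrics are positive definite.) The Hodge operator on `Λ²` of `(f g, f² vol)`
does not depend on `f`: the choice of `vol` up to this equivalence is the choice of one of the two
Hodge operators that are compatible with the class of `g`. -/
structure OrientedConformalStructure (𝕜 : Type*) [RCLike 𝕜] (M : Type*) [TopologicalSpace M]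
    [ChartedSpace (Coord 𝕜 4) M] where
  rep : ∀ x : M, Set (TBil 𝕜 4 x × TVol 𝕜 4 x)
  exists_local : ∀ x : M, ∃ U : Set M, IsOpen U ∧ x ∈ U ∧
    ∃ (g : ∀ y : M, TBil 𝕜 4 y) (vol : ∀ y : M, TVol 𝕜 4 y), IsMetricOn U g ∧ IsVolumeOn U g vol ∧
      ∀ y ∈ U, rep y = {p | ∃ f : 𝕜, f ≠ 0 ∧ p.1 = f • g y ∧ p.2 = f ^ 2 • vol y}

/-- `g` is a metric of the conformal class `c` on the open set `U`, and `vol` is the volume form of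
norm one that the orientation assigns to it. -/
structure IsLocalMetric (c : OrientedConformalStructure 𝕜 M) (U : Set M)
    (g : ∀ x : M, TBil 𝕜 4 x) (vol : ∀ x : M, TVol 𝕜 4 x) : Prop where
  isOpen : IsOpen U
  metric : IsMetricOn U g
  volume : IsVolumeOn U g vol
  mem : ∀ x ∈ U, (g x, vol x) ∈ c.rep x

/-- The Weyl tensor `g(W(u,v)w, t)` of `g` at `x ∈ M`, computed in the chart `φ`. -/
def weylAt (φ : OpenPartialHomeomorph M (Coord 𝕜 4)) (g : ∀ x : M, TBil 𝕜 4 x) (x : M)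
    (u v w t : TangentSpace 𝓘(𝕜, Coord 𝕜 4) x) : 𝕜 :=
  weyl (bilInChart φ g) (φ x)
    (vecInChart φ x u) (vecInChart φ x v) (vecInChart φ x w) (vecInChart φ x t)

/-- The anti-self-dual Weyl tensor `g(W⁻(u,v)w, t)` at `x ∈ M`, computed in the chart `φ`. -/
def weylMinusAt (φ : OpenPartialHomeomorph M (Coord 𝕜 4)) (g : ∀ x : M, TBil 𝕜 4 x)
    (vol : ∀ x : M, TVol 𝕜 4 x) (x : M) (u v w t : TangentSpace 𝓘(𝕜, Coord 𝕜 4) x) : 𝕜 :=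
  weylMinus (bilInChart φ g) (volInChart φ vol) (φ x)
    (vecInChart φ x u) (vecInChart φ x v) (vecInChart φ x w) (vecInChart φ x t)

/-- The derivative `g((∇ₘ W⁺)(u,v)w, t)` of the self-dual Weyl tensor at `x ∈ M`, for the
Levi-Civita connection of `g`, computed in the chart `φ`; as `∇ g = 0`, it is the covariant
derivative of the `4`-tensor `g(W⁺(u,v)w, t)`. -/
def nablaWeylPlusAt (φ : OpenPartialHomeomorph M (Coord 𝕜 4)) (g : ∀ x : M, TBil 𝕜 4 x)
    (vol : ∀ x : M, TVol 𝕜 4 x) (x : M) (m u v w t : TangentSpace 𝓘(𝕜, Coord 𝕜 4) x) : 𝕜 :=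
  covDeriv (bilInChart φ g) (weylPlus (bilInChart φ g) (volInChart φ vol)) (φ x)
    (vecInChart φ x m) (vecInChart φ x u) (vecInChart φ x v) (vecInChart φ x w) (vecInChart φ x t)

/-- `(M, c)` is self-dual: `W⁻ = 0`. As `W⁻` is a tensor that, up to the scale of the metric,
depends on `c` only, the metric of the class and the chart are immaterial. -/
def IsSelfDual (c : OrientedConformalStructure 𝕜 M) : Prop :=
  ∀ U g vol, IsLocalMetric c U g vol → ∀ φ ∈ atlas (Coord 𝕜 4) M, ∀ x ∈ φ.source ∩ U,
    ∀ u v w t, weylMinusAt φ g vol x u v w t = 0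

end Conformal

/-! ### Hypersurfaces -/

section Hypersurfaces

variable {𝕜 : Type*} [RCLike 𝕜]
  {M : Type*} [TopologicalSpace M] [ChartedSpace (Coord 𝕜 4) M]
  {Q : Type*} [TopologicalSpace Q] [ChartedSpace (Coord 𝕜 3) Q]

/-- The image in `T_{ι q} M` of a vector tangent to the hypersurface at `q`. -/
def push (ι : Q → M) (q : Q) (X : TangentSpace 𝓘(𝕜, Coord 𝕜 3) q) :
    TangentSpace 𝓘(𝕜, Coord 𝕜 4) (ι q) :=
  mfderiv 𝓘(𝕜, Coord 𝕜 3) 𝓘(𝕜, Coord 𝕜 4) ι q X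

/-- `ι : Q → M` is an (immersed) hypersurface on which `c` induces a nondegenerate conformal
structure. -/
structure IsNondegenerateHypersurface (c : OrientedConformalStructure 𝕜 M) (ι : Q → M) : Prop where
  smooth : ContMDiff 𝓘(𝕜, Coord 𝕜 3) 𝓘(𝕜, Coord 𝕜 4) ∞ ι
  immersion : ∀ q, Function.Injective (push (𝕜 := 𝕜) ι q)
  nondegenerate : ∀ U g vol, IsLocalMetric c U g vol → ∀ q, ι q ∈ U →
    ∀ X : TangentSpace 𝓘(𝕜, Coord 𝕜 3) q,
      (∀ Y : TangentSpace 𝓘(𝕜, Coord 𝕜 3) q, pullback ι g q X Y = 0) → X = 0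

/-- The hypersurface is umbilic: at each point its second fundamental form in any normal direction
is a multiple of the induced metric. This property does not depend on the metric of the class, nor
on the charts `φ` of `M` and `ψ` of `Q` in which the second fundamental form is computed. -/
def IsUmbilic (c : OrientedConformalStructure 𝕜 M) (ι : Q → M) : Prop :=
  ∀ U g vol, IsLocalMetric c U g vol → ∀ φ ∈ atlas (Coord 𝕜 4) M, ∀ ψ ∈ atlas (Coord 𝕜 3) Q,
    ∀ q ∈ ψ.source, ι q ∈ φ.source ∩ U →
    ∀ ν : TangentSpace 𝓘(𝕜, Coord 𝕜 4) (ι q),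
      (∀ Z : TangentSpace 𝓘(𝕜, Coord 𝕜 3) q, g (ι q) (push ι q Z) ν = 0) →
      ∃ H : 𝕜, ∀ X Y : TangentSpace 𝓘(𝕜, Coord 𝕜 3) q,
        secondFundamentalForm (bilInChart φ g) (φ ∘ ι ∘ ψ.symm) (ψ q) (vecInChart φ (ι q) ν)
          (vecInChart ψ q X) (vecInChart ψ q Y) = H * pullback ι g q X Y

/-- The Cotton–York tensor `C(X, Y)(Z)` of a metric `γ` on the `3`-manifold `Q` at `q`, computed in
the chart `ψ`. -/
def cottonAt (ψ : OpenPartialHomeomorph Q (Coord 𝕜 3)) (γ : ∀ q : Q, TBil 𝕜 3 q) (q : Q)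
    (X Y Z : TangentSpace 𝓘(𝕜, Coord 𝕜 3) q) : 𝕜 :=
  cotton (bilInChart ψ γ) (ψ q) (vecInChart ψ q X) (vecInChart ψ q Y) (vecInChart ψ q Z)

/-- The relation `S = *(X ∧ Y)` for the Hodge operator `* : Λ² T_q Q → T_q Q` of the metric induced
by `g` and of the orientation of `Q` for which an orthonormal basis `(e₁, e₂, e₃)` of `T_q Q` is
positive iff `vol(e₁, e₂, e₃, ν) = 1`: namely `g(S, Z) = vol(X, Y, Z, ν)` for all `Z ∈ T_q Q`.
As the induced metric is nondegenerate, there is exactly one such `S`. As `dim Q = 3`, every element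
of `Λ² T_q Q` is of the form `X ∧ Y`. -/
def IsHodgeStar (ι : Q → M) (g : ∀ x : M, TBil 𝕜 4 x) (vol : ∀ x : M, TVol 𝕜 4 x) (q : Q)
    (ν : TangentSpace 𝓘(𝕜, Coord 𝕜 4) (ι q)) (X Y S : TangentSpace 𝓘(𝕜, Coord 𝕜 3) q) : Prop :=
  ∀ Z : TangentSpace 𝓘(𝕜, Coord 𝕜 3) q,
    pullback ι g q S Z = vol (ι q) ![push ι q X, push ι q Y, push ι q Z, ν]

end Hypersurfaces

end UmbilicHypersurface

end

open UmbilicHypersurface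

/-! ### Linear algebra of forms with orthonormal bases. -/

section Orthonormal

variable {𝕜 : Type*} [RCLike 𝕜] {n : ℕ}

/-! Everything is computed in charts, for a local parametrization F of Q with induced metric γ.
Umbilicity says that the second fundamental form is γ ⊗ h with h the mean curvature vector field
(`exists_meanCurvature`). Differentiating the Gauss formula gives R(X,Y)Z = F_*(R^Q(X,Y)Z) - γ(Y,Z)
D_X h + γ(X,Z) D_Y h on tangent vectors (`connCurv_map_eq`).

Vanishing of W on Q. Paired with the unit normal ν, this equation makes W(X,Y,Z,ν) a pure trace,
γ(X,Z) a(Y) - γ(Y,Z) a(X) (`weyl_normal`). As W is trace-free, a = 0 (`eq_zero_of_codazzi`), so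
W(X,Y,Z,ν) = 0. The Hodge operator exchanges tangential bivectors with the bivectors X ∧ ν, hence a
self-dual W is determined by these components and vanishes (`eq_zero_of_normal_eq_zero`).

The normal derivative. Since W = 0 along Q, ∇W⁺ at x is the plain derivative of the components of W,
and it is zero in tangential directions. The normal derivative D_νW is again self-dual and
trace-free, because the derivatives of the coefficients in these linear identities multiply W(x) = 0
(`isSelfDualWeyl_fderiv_weyl`). At a zero of W the second Bianchi identity expresses the cyclic sum
of DW through the Cotton-York tensor C of M (`weyl_bianchi`). With all arguments tangent it says
that C is trace-free along Q; with ν in the first and last places it gives D_νW(X,Y,Z,ν) = -C(X,Y,Z)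
plus a pure trace, which is zero for the same reason as a. Self-duality then turns Z ∧ T into *_Q(Z
∧ T) ∧ ν (`apply_eq_of_hodgeStar`).

It remains to see that C restricts to the Cotton-York tensor of Q (`cotton_tangent`). By the Gauss
equation and W = 0, the normalized Ricci tensors of M and Q differ on TQ by ½ g(h,h) γ; the equation
a = 0 computes the derivative of g(h,h), and the extra terms cancel upon antisymmetrization. -/

/-- `b` is an orthonormal family of the bilinear form `β`. -/
def IsOrthonormalFor {E : Type*} [NormedAddCommGroup E] [NormedSpace 𝕜 E] {ι : Type*}
    [DecidableEq ι] (β : Bil 𝕜 E) (b : ι → E) : Prop :=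
  ∀ i j, β (b i) (b j) = if i = j then 1 else 0

theorem IsOrthonormalFor.linearIndependent {E : Type*} [NormedAddCommGroup E] [NormedSpace 𝕜 E]
    {ι : Type*} [DecidableEq ι] [Fintype ι] {β : Bil 𝕜 E} {b : ι → E} (hb : IsOrthonormalFor β b) :
    LinearIndependent 𝕜 b := by
  rw [Fintype.linearIndependent_iff]
  intro c hc i
  have h := congrArg (β (b i)) hc
  simpa [map_sum, hb i] using h

theorem IsOrthonormalFor.sum_repr {β : Bil 𝕜 (Coord 𝕜 n)} {b : Fin n → Coord 𝕜 n}
    (hb : IsOrthonormalFor β b) (v : Coord 𝕜 n) : v = ∑ i, β (b i) v • b i := by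
  have hs : v ∈ Submodule.span 𝕜 (Set.range b) := by
    rw [hb.linearIndependent.span_eq_top_of_card_eq_finrank' (by simp)]
    trivial
  obtain ⟨c, rfl⟩ := (Submodule.mem_span_range_iff_exists_fun 𝕜).1 hs
  refine Finset.sum_congr rfl fun i _ => ?_
  simp [map_sum, hb i]

theorem IsOrthonormalFor.eq_zero {β : Bil 𝕜 (Coord 𝕜 n)} {b : Fin n → Coord 𝕜 n}
    (hb : IsOrthonormalFor β b) {v : Coord 𝕜 n} (hv : ∀ i, β (b i) v = 0) : v = 0 := by
  rw [hb.sum_repr v]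
  simp [hv]

theorem isInvertible_of_symm_of_nondegenerate {β : Bil 𝕜 (Coord 𝕜 n)}
    (hn : ∀ v, (∀ w, β v w = 0) → v = 0) : β.IsInvertible := by
  have hinj : Function.Injective (β : Coord 𝕜 n →ₗ[𝕜] (Coord 𝕜 n →L[𝕜] 𝕜)) := by
    rw [injective_iff_map_eq_zero]
    intro v hv
    exact hn v fun w => by
      have := congrArg (fun f : Coord 𝕜 n →L[𝕜] 𝕜 => f w) hv
      simpa using this
  have hfr : Module.finrank 𝕜 (Coord 𝕜 n) = Module.finrank 𝕜 (Coord 𝕜 n →L[𝕜] 𝕜) := by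
    rw [← (LinearMap.toContinuousLinearMap (𝕜 := 𝕜) (E := Coord 𝕜 n) (F' := 𝕜)).finrank_eq]
    exact (Subspace.dual_finrank_eq (K := 𝕜) (V := Coord 𝕜 n)).symm
  refine ⟨(LinearEquiv.ofInjectiveOfFinrankEq _ hinj hfr).toContinuousLinearEquiv, ?_⟩
  ext v w
  rfl

theorem inverse_apply_apply {β : Bil 𝕜 (Coord 𝕜 n)} (hβ : β.IsInvertible)
    (f : Coord 𝕜 n →L[𝕜] 𝕜) : β (β.inverse f) = f := by
  obtain ⟨e, rfl⟩ := hβ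
  simp

theorem inverse_eq_of_forall {β : Bil 𝕜 (Coord 𝕜 n)} (hβ : β.IsInvertible)
    {f : Coord 𝕜 n →L[𝕜] 𝕜} {v : Coord 𝕜 n} (h : ∀ w, β v w = f w) : β.inverse f = v := by
  obtain ⟨e, rfl⟩ := hβ
  have : f = (e : Coord 𝕜 n →L[𝕜] (Coord 𝕜 n →L[𝕜] 𝕜)) v := by ext w; exact (h w).symm
  rw [this]
  simp

theorem eq_of_forall_apply_eq {β : Bil 𝕜 (Coord 𝕜 n)} (hβ : β.IsInvertible)
    {v w : Coord 𝕜 n} (h : ∀ t, β v t = β w t) : v = w := by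
  obtain ⟨e, rfl⟩ := hβ
  refine e.injective ?_
  ext t
  simpa using h t

theorem IsOrthonormalFor.isInvertible {β : Bil 𝕜 (Coord 𝕜 n)} {b : Fin n → Coord 𝕜 n}
    (hb : IsOrthonormalFor β b) (hs : ∀ u v, β u v = β v u) : β.IsInvertible :=
  isInvertible_of_symm_of_nondegenerate fun v hv => hb.eq_zero fun i => by rw [hs, hv]

theorem apply_dualVec {β : Bil 𝕜 (Coord 𝕜 n)} (hβ : β.IsInvertible) (i : Fin n)
    (v : Coord 𝕜 n) : β (dualVec β i) v = v i := by
  rw [dualVec, inverse_apply_apply hβ]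
  rfl

theorem sum_coordVec (v : Coord 𝕜 n) : ∑ i, v i • coordVec 𝕜 i = v := by
  ext j
  simp [coordVec, Finset.sum_apply, Pi.single_apply]

theorem IsOrthonormalFor.dualVec_eq {β : Bil 𝕜 (Coord 𝕜 n)} {b : Fin n → Coord 𝕜 n}
    (hb : IsOrthonormalFor β b) (hs : ∀ u v, β u v = β v u) (i : Fin n) :
    dualVec β i = ∑ a, b a i • b a := by
  refine inverse_eq_of_forall (hb.isInvertible hs) fun w => ?_
  conv_rhs => rw [hb.sum_repr w]
  simp [map_sum, mul_comm]

/-- The contraction of a bilinear form computed in coordinates and in an orthonormal basis. -/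
theorem IsOrthonormalFor.sum_coordVec_dualVec {β : Bil 𝕜 (Coord 𝕜 n)} {b : Fin n → Coord 𝕜 n}
    (hb : IsOrthonormalFor β b) (hs : ∀ u v, β u v = β v u)
    (f : Coord 𝕜 n →ₗ[𝕜] Coord 𝕜 n →ₗ[𝕜] 𝕜) :
    ∑ i, f (coordVec 𝕜 i) (dualVec β i) = ∑ a, f (b a) (b a) := by
  simp_rw [hb.dualVec_eq hs, map_sum]
  rw [Finset.sum_comm]
  refine Finset.sum_congr rfl fun a _ => ?_
  have h : f (b a) (b a) = f (∑ i, b a i • coordVec 𝕜 i) (b a) := by rw [sum_coordVec]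
  rw [h, map_sum, LinearMap.sum_apply]
  exact Finset.sum_congr rfl fun i _ => by simp

/-- Over ℝ the sum is nonnegative, and ℂ is algebraically closed. The two fields are distinguished
only here. The consequence is that all values `β v v` of a form with an orthonormal basis are
squares, a property which the induced metric on a subspace inherits. -/
theorem exists_sq_eq_sum_sq {ι : Type*} (s : Finset ι) (c : ι → 𝕜) :
    ∃ r : 𝕜, r ^ 2 = ∑ i ∈ s, c i ^ 2 := by
  rcases RCLike.I_eq_zero_or_im_I_eq_one (K := 𝕜) with h | h
  · have hc : ∀ z : 𝕜, z = (RCLike.re z : 𝕜) := fun z => by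
      conv_lhs => rw [← RCLike.re_add_im z, h]
      simp
    refine ⟨(Real.sqrt (∑ i ∈ s, RCLike.re (c i) ^ 2) : ℝ), ?_⟩
    rw [← RCLike.ofReal_pow, Real.sq_sqrt (Finset.sum_nonneg fun i _ => sq_nonneg _)]
    push_cast
    exact Finset.sum_congr rfl fun i _ => congrArg (· ^ 2) (hc (c i)).symm
  · let e := RCLike.complexRingEquiv h
    obtain ⟨r, hr⟩ := IsAlgClosed.exists_pow_nat_eq (e (∑ i ∈ s, c i ^ 2)) (n := 2) two_pos
    exact ⟨e.symm r, by rw [← map_pow, hr, RingEquiv.symm_apply_apply]⟩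

theorem IsOrthonormalFor.exists_sq_eq {β : Bil 𝕜 (Coord 𝕜 n)} {b : Fin n → Coord 𝕜 n}
    (hb : IsOrthonormalFor β b) (hs : ∀ u v, β u v = β v u) (v : Coord 𝕜 n) :
    ∃ r : 𝕜, r ^ 2 = β v v := by
  obtain ⟨r, hr⟩ := exists_sq_eq_sum_sq Finset.univ fun i => β (b i) v
  refine ⟨r, hr.trans ?_⟩
  conv_rhs => enter [2]; rw [hb.sum_repr v]
  rw [map_sum]
  exact Finset.sum_congr rfl fun i _ => by rw [map_smul, smul_eq_mul, hs v, sq]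

/-- A nondegenerate symmetric form all of whose values `β v v` are squares has an orthonormal
basis. -/
theorem exists_isOrthonormalFor {β : Bil 𝕜 (Coord 𝕜 n)} (hs : ∀ u v, β u v = β v u)
    (hn : ∀ v, (∀ w, β v w = 0) → v = 0) (hsq : ∀ v, ∃ r : 𝕜, r ^ 2 = β v v) :
    ∃ b : Fin n → Coord 𝕜 n, IsOrthonormalFor β b := by
  let B : LinearMap.BilinForm 𝕜 (Coord 𝕜 n) :=
    LinearMap.mk₂ 𝕜 (fun u v => β u v) (by simp) (by simp) (by simp) (by simp)
  have hBs : LinearMap.IsSymm B := ⟨fun u v => hs u v⟩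
  obtain ⟨v, hv⟩ := LinearMap.BilinForm.exists_orthogonal_basis (B := B) hBs
  have hfr : Module.finrank 𝕜 (Coord 𝕜 n) = n := by simp
  let v' : Module.Basis (Fin n) 𝕜 (Coord 𝕜 n) := v.reindex (finCongr hfr)
  have hv' : ∀ i j, i ≠ j → β (v' i) (v' j) = 0 := by
    intro i j hij
    have := hv (i := (finCongr hfr).symm i) (j := (finCongr hfr).symm j) (by simpa using hij)
    simpa [v', B, Function.onFun] using this
  have hne : ∀ i, β (v' i) (v' i) ≠ 0 := by
    intro i h0
    refine v'.ne_zero i (hn _ fun w => ?_)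
    rw [← v'.sum_repr w, map_sum]
    refine Finset.sum_eq_zero fun j _ => ?_
    by_cases hij : i = j
    · subst hij; simp [h0]
    · simp [hv' i j hij]
  choose r hr using hsq
  have hr0 : ∀ i, r (v' i) ≠ 0 := fun i h => hne i (by rw [← hr, h]; simp)
  refine ⟨fun i => (r (v' i))⁻¹ • v' i, fun i j => ?_⟩
  by_cases hij : i = j
  · subst hij
    have := hr (v' i)
    simp only [map_smul, smul_apply, smul_eq_mul, ← this, if_true]
    field_simp [hr0 i]
  · simp [hv' i j hij, hij]

/-- An orthonormal basis adapted to a nondegenerate hyperplane. -/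
theorem IsOrthonormalFor.exists_normal {β : Bil 𝕜 (Coord 𝕜 (n + 1))}
    {b : Fin (n + 1) → Coord 𝕜 (n + 1)} (hb : IsOrthonormalFor β b)
    (hs : ∀ u v, β u v = β v u) {e : Fin n → Coord 𝕜 (n + 1)} (he : IsOrthonormalFor β e) :
    ∃ ν, (∀ i, β (e i) ν = 0) ∧ β ν ν = 1 := by
  let T : Coord 𝕜 (n + 1) →ₗ[𝕜] (Fin n → 𝕜) := LinearMap.pi fun i => (β (e i) : _ →ₗ[𝕜] 𝕜)
  have hker : LinearMap.ker T ≠ ⊥ := LinearMap.ker_ne_bot_of_finrank_lt (by simp)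
  obtain ⟨m, hm, hm0⟩ := (Submodule.ne_bot_iff _).1 hker
  have hem : ∀ i, β (e i) m = 0 := fun i => congrFun (LinearMap.mem_ker.1 hm) i
  -- An isotropic `m` would be orthogonal to itself and to every `e i`. These vectors are
  -- independent, hence span, so `m` would lie in the kernel of `β`.
  have hmm : β m m ≠ 0 := by
    intro h0
    have hli : LinearIndependent 𝕜 (Fin.cons m e : Fin (n + 1) → Coord 𝕜 (n + 1)) := by
      rw [linearIndependent_finCons]
      refine ⟨he.linearIndependent, fun hmem => hm0 ?_⟩
      obtain ⟨c, hc⟩ := (Submodule.mem_span_range_iff_exists_fun 𝕜).1 hmem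
      have hc0 : ∀ i, c i = 0 := fun i => by
        have := hem i
        rw [← hc] at this
        simpa [map_sum, he i] using this
      rw [← hc]; simp [hc0]
    have htop := hli.span_eq_top_of_card_eq_finrank' (by simp)
    refine hm0 (hb.eq_zero fun i => ?_)
    have hbi : b i ∈ Submodule.span 𝕜 (Set.range (Fin.cons m e : Fin (n + 1) → Coord 𝕜 (n + 1))) := by
      rw [htop]; trivial
    obtain ⟨c, hc⟩ := (Submodule.mem_span_range_iff_exists_fun 𝕜).1 hbi
    rw [← hc]
    simp [Fin.sum_univ_succ, map_sum, h0, hem]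
  obtain ⟨r, hr⟩ := hb.exists_sq_eq hs m
  have hr0 : r ≠ 0 := fun h => hmm (by rw [← hr, h]; simp)
  refine ⟨r⁻¹ • m, fun i => by simp [hem], ?_⟩
  simp only [map_smul, smul_apply, smul_eq_mul, ← hr]
  field_simp

theorem IsOrthonormalFor.cons {β : Bil 𝕜 (Coord 𝕜 (n + 1))} (hs : ∀ u v, β u v = β v u)
    {e : Fin n → Coord 𝕜 (n + 1)} (he : IsOrthonormalFor β e) {ν : Coord 𝕜 (n + 1)}
    (hν : ∀ i, β (e i) ν = 0) (h1 : β ν ν = 1) :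
    IsOrthonormalFor β (Fin.cons ν e : Fin (n + 1) → Coord 𝕜 (n + 1)) := by
  intro i j
  refine Fin.cases ?_ (fun i => ?_) i <;> refine Fin.cases ?_ (fun j => ?_) j
  · simpa using h1
  · simpa [hs ν, Fin.succ_ne_zero, eq_comm] using hν j
  · simpa [Fin.succ_ne_zero] using hν i
  · simpa using he i j

end Orthonormal

/-! ### Pointwise rules of differentiation. -/

section Derivatives

variable {𝕜 : Type*} [RCLike 𝕜]
  {E F G H : Type*} [NormedAddCommGroup E] [NormedSpace 𝕜 E] [NormedAddCommGroup F]
  [NormedSpace 𝕜 F] [NormedAddCommGroup G] [NormedSpace 𝕜 G] [NormedAddCommGroup H]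
  [NormedSpace 𝕜 H]

theorem fderiv_clm_apply_apply {A : E → F →L[𝕜] G} {f : E → F} {x : E}
    (hA : DifferentiableAt 𝕜 A x) (hf : DifferentiableAt 𝕜 f x) (m : E) :
    fderiv 𝕜 (fun y => A y (f y)) x m = fderiv 𝕜 A x m (f x) + A x (fderiv 𝕜 f x m) := by
  rw [fderiv_clm_apply hA hf]
  simp [add_comm]

theorem fderiv_clm_apply_const {A : E → F →L[𝕜] G} {x : E}
    (hA : DifferentiableAt 𝕜 A x) (u : F) (m : E) :
    fderiv 𝕜 (fun y => A y u) x m = fderiv 𝕜 A x m u := by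
  rw [fderiv_clm_apply_apply hA (differentiableAt_const u)]
  simp

theorem fderiv_clm_apply_const₂ {A : E → F →L[𝕜] G →L[𝕜] H} {x : E}
    (hA : DifferentiableAt 𝕜 A x) (u : F) (v : G) (m : E) :
    fderiv 𝕜 (fun y => A y u v) x m = fderiv 𝕜 A x m u v := by
  rw [fderiv_clm_apply_const (hA.clm_apply (differentiableAt_const u)),
    fderiv_clm_apply_const hA]

theorem fderiv_clm_apply_apply₂ {A : E → F →L[𝕜] G →L[𝕜] H} {f : E → F} {k : E → G} {x : E}
    (hA : DifferentiableAt 𝕜 A x) (hf : DifferentiableAt 𝕜 f x) (hk : DifferentiableAt 𝕜 k x)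
    (m : E) :
    fderiv 𝕜 (fun y => A y (f y) (k y)) x m =
      fderiv 𝕜 A x m (f x) (k x) + A x (fderiv 𝕜 f x m) (k x) + A x (f x) (fderiv 𝕜 k x m) := by
  rw [fderiv_clm_apply_apply (hA.clm_apply hf) hk, fderiv_clm_apply_apply hA hf]
  simp

theorem fderiv_add_apply' {f k : E → F} {x : E}
    (hf : DifferentiableAt 𝕜 f x) (hk : DifferentiableAt 𝕜 k x) (m : E) :
    fderiv 𝕜 (fun y => f y + k y) x m = fderiv 𝕜 f x m + fderiv 𝕜 k x m := by
  rw [fderiv_fun_add hf hk]; rfl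

theorem fderiv_sub_apply' {f k : E → F} {x : E}
    (hf : DifferentiableAt 𝕜 f x) (hk : DifferentiableAt 𝕜 k x) (m : E) :
    fderiv 𝕜 (fun y => f y - k y) x m = fderiv 𝕜 f x m - fderiv 𝕜 k x m := by
  rw [fderiv_fun_sub hf hk]; rfl

theorem fderiv_neg_apply' {f : E → F} {x : E} (m : E) :
    fderiv 𝕜 (fun y => - f y) x m = - fderiv 𝕜 f x m := by
  rw [fderiv_fun_neg]; rfl

theorem fderiv_mul_apply' {f k : E → 𝕜} {x : E}
    (hf : DifferentiableAt 𝕜 f x) (hk : DifferentiableAt 𝕜 k x) (m : E) :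
    fderiv 𝕜 (fun y => f y * k y) x m = fderiv 𝕜 f x m * k x + f x * fderiv 𝕜 k x m := by
  rw [fderiv_fun_mul hf hk]
  simp; ring

theorem fderiv_smul_apply' {f : E → 𝕜} {k : E → F} {x : E}
    (hf : DifferentiableAt 𝕜 f x) (hk : DifferentiableAt 𝕜 k x) (m : E) :
    fderiv 𝕜 (fun y => f y • k y) x m = fderiv 𝕜 f x m • k x + f x • fderiv 𝕜 k x m := by
  rw [fderiv_fun_smul hf hk]
  simp [add_comm]

theorem fderiv_sum_apply' {ι : Type*} {s : Finset ι} {f : ι → E → F} {x : E}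
    (hf : ∀ i ∈ s, DifferentiableAt 𝕜 (f i) x) (m : E) :
    fderiv 𝕜 (fun y => ∑ i ∈ s, f i y) x m = ∑ i ∈ s, fderiv 𝕜 (f i) x m := by
  rw [fderiv_fun_sum hf]
  simp

theorem fderiv_apply_eq_of_eventuallyEq {f k : E → F} {x : E} (h : ∀ᶠ y in 𝓝 x, f y = k y)
    (m : E) : fderiv 𝕜 f x m = fderiv 𝕜 k x m := by
  rw [Filter.EventuallyEq.fderiv_eq h]

theorem ContDiffAt.fderiv_infty {f : E → F} {x : E} (hf : ContDiffAt 𝕜 ∞ f x) :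
    ContDiffAt 𝕜 ∞ (fderiv 𝕜 f) x :=
  hf.fderiv_right (m := ∞) (by simp)

theorem ContDiffAt.differentiableAt_infty {f : E → F} {x : E} (hf : ContDiffAt 𝕜 ∞ f x) :
    DifferentiableAt 𝕜 f x :=
  hf.differentiableAt (by simp)

theorem ContDiffAt.fderiv_fderiv_comm {f : E → F} {x : E} (hf : ContDiffAt 𝕜 ∞ f x) (u v : E) :
    fderiv 𝕜 (fderiv 𝕜 f) x u v = fderiv 𝕜 (fderiv 𝕜 f) x v u :=
  (hf.isSymmSndFDerivAt (by
    rw [minSmoothness_of_isRCLikeNormedField]; exact ENat.LEInfty.out)) u v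

end Derivatives

/-! ### Bundling pointwise multilinear functions. -/

section Bundling

variable {𝕜 : Type*} [RCLike 𝕜] {n : ℕ} {F : Type*} [NormedAddCommGroup F] [NormedSpace 𝕜 F]

/-- The continuous bilinear map with the same values as `f` on coordinate vectors. -/
noncomputable def bilOfCoord (f : Coord 𝕜 n → Coord 𝕜 n → F) : Coord 𝕜 n →L[𝕜] Coord 𝕜 n →L[𝕜] F :=
  ∑ i, ∑ j, (EuclideanSpace.proj i : Coord 𝕜 n →L[𝕜] 𝕜).smulRight
    ((EuclideanSpace.proj j : Coord 𝕜 n →L[𝕜] 𝕜).smulRight (f (coordVec 𝕜 i) (coordVec 𝕜 j)))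

theorem IsLinearMap.eq_sum_coordVec {f : Coord 𝕜 n → F} (hf : IsLinearMap 𝕜 f) (v : Coord 𝕜 n) :
    f v = ∑ i, v i • f (coordVec 𝕜 i) := by
  conv_lhs => rw [← sum_coordVec v]
  exact (map_sum (hf.mk' f) _ _).trans (by simp)

/-- Christoffel symbols and Ricci tensors are given as plain functions of vectors. Once bundled they
can be differentiated as maps into a normed space, with smoothness checked on finitely many
components. -/
theorem bilOfCoord_apply {f : Coord 𝕜 n → Coord 𝕜 n → F} (h₁ : ∀ v, IsLinearMap 𝕜 fun u => f u v)
    (h₂ : ∀ u, IsLinearMap 𝕜 (f u)) (u v : Coord 𝕜 n) : bilOfCoord f u v = f u v := by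
  rw [(h₁ v).eq_sum_coordVec u]
  simp only [bilOfCoord, sum_apply, ContinuousLinearMap.smulRight_apply,
    smul_apply, PiLp.proj_apply]
  refine Finset.sum_congr rfl fun i _ => ?_
  rw [(h₂ _).eq_sum_coordVec v, Finset.smul_sum]

variable {X : Type*} [NormedAddCommGroup X] [NormedSpace 𝕜 X]

theorem contDiffAt_bilOfCoord {f : X → Coord 𝕜 n → Coord 𝕜 n → F} {x : X} {k : ℕ∞ω}
    (hf : ∀ i j, ContDiffAt 𝕜 k (fun y => f y (coordVec 𝕜 i) (coordVec 𝕜 j)) x) :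
    ContDiffAt 𝕜 k (fun y => bilOfCoord (f y)) x := by
  unfold bilOfCoord
  refine ContDiffAt.sum fun i _ => ContDiffAt.sum fun j _ => ?_
  exact contDiffAt_const.smulRight (contDiffAt_const.smulRight (hf i j))

/-- `f` is linear in each of its four arguments. -/
structure IsQuadrilinear {E : Type*} [AddCommGroup E] [Module 𝕜 E] (f : E → E → E → E → 𝕜) :
    Prop where
  fst : ∀ v w t, IsLinearMap 𝕜 fun u => f u v w t
  snd : ∀ u w t, IsLinearMap 𝕜 fun v => f u v w t
  trd : ∀ u v t, IsLinearMap 𝕜 fun w => f u v w t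
  fth : ∀ u v w, IsLinearMap 𝕜 fun t => f u v w t

theorem IsQuadrilinear.exists_linearMap {E : Type*} [AddCommGroup E] [Module 𝕜 E]
    {f : E → E → E → E → 𝕜} (hf : IsQuadrilinear f) :
    ∃ T : E →ₗ[𝕜] E →ₗ[𝕜] E →ₗ[𝕜] E →ₗ[𝕜] 𝕜, ∀ u v w t, T u v w t = f u v w t := by
  refine ⟨LinearMap.mk₂ 𝕜 (fun u v => LinearMap.mk₂ 𝕜 (fun w t => f u v w t)
    (fun w w' t => (hf.trd u v t).map_add w w') (fun c w t => (hf.trd u v t).map_smul c w)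
    (fun w t t' => (hf.fth u v w).map_add t t') (fun c w t => (hf.fth u v w).map_smul c t))
    (fun u u' v => ?_) (fun c u v => ?_) (fun u v v' => ?_) (fun c u v => ?_),
    fun u v w t => rfl⟩ <;> refine LinearMap.ext fun w => LinearMap.ext fun t => ?_
  · exact (hf.fst v w t).map_add u u'
  · exact (hf.fst v w t).map_smul c u
  · exact (hf.snd u w t).map_add v v'
  · exact (hf.snd u w t).map_smul c v

/-- Linearity is a family of identities between functions of the base point. They are required near
`x`, not only at `x`, because they get differentiated. -/
theorem isLinearMap_fderiv {E F X : Type*} [AddCommGroup E] [Module 𝕜 E] [NormedAddCommGroup F]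
    [NormedSpace 𝕜 F] [NormedAddCommGroup X] [NormedSpace 𝕜 X] {f : X → E → F} {x : X}
    (hf : ∀ᶠ y in 𝓝 x, IsLinearMap 𝕜 (f y)) (hd : ∀ u, DifferentiableAt 𝕜 (fun y => f y u) x)
    (m : X) : IsLinearMap 𝕜 fun u => fderiv 𝕜 (fun y => f y u) x m where
  map_add u v := by
    rw [← fderiv_add_apply' (hd u) (hd v)]
    exact fderiv_apply_eq_of_eventuallyEq (hf.mono fun y hy => hy.map_add u v) m
  map_smul c u := by
    rw [fderiv_apply_eq_of_eventuallyEq (hf.mono fun y hy => hy.map_smul c u) m,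
      fderiv_fun_const_smul (hd u)]
    rfl

theorem isQuadrilinear_fderiv {E X : Type*} [AddCommGroup E] [Module 𝕜 E]
    [NormedAddCommGroup X] [NormedSpace 𝕜 X] {f : X → E → E → E → E → 𝕜} {x : X}
    (hf : ∀ᶠ y in 𝓝 x, IsQuadrilinear (f y))
    (hd : ∀ u v w t, DifferentiableAt 𝕜 (fun y => f y u v w t) x) (m : X) :
    IsQuadrilinear fun u v w t => fderiv 𝕜 (fun y => f y u v w t) x m where
  fst v w t := isLinearMap_fderiv (hf.mono fun _ hy => hy.fst v w t) (fun u => hd u v w t) m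
  snd u w t := isLinearMap_fderiv (hf.mono fun _ hy => hy.snd u w t) (fun v => hd u v w t) m
  trd u v t := isLinearMap_fderiv (hf.mono fun _ hy => hy.trd u v t) (fun w => hd u v w t) m
  fth u v w := isLinearMap_fderiv (hf.mono fun _ hy => hy.fth u v w) (fun t => hd u v w t) m

end Bundling

/-! ### Curvature of an arbitrary connection and the Bianchi identities. -/

section Connection

variable {𝕜 : Type*} [RCLike 𝕜] {E : Type*} [NormedAddCommGroup E] [NormedSpace 𝕜 E]

/-- The curvature `∇_[u,v] - [∇ᵤ, ∇ᵥ]` of the connection with Christoffel symbols `Γ`. -/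
noncomputable def connCurv (Γ : E → E →L[𝕜] E →L[𝕜] E) (y u v w : E) : E :=
  -(fderiv 𝕜 Γ y u v w - fderiv 𝕜 Γ y v u w + Γ y u (Γ y v w) - Γ y v (Γ y u w))

theorem contDiffAt_connCurv {Γ : E → E →L[𝕜] E →L[𝕜] E} {x : E} (hΓ : ContDiffAt 𝕜 ∞ Γ x)
    (u v w : E) : ContDiffAt 𝕜 ∞ (fun y => connCurv Γ y u v w) x := by
  have h := hΓ.fderiv_infty
  have hc : ∀ u : E, ContDiffAt 𝕜 ∞ (fun _ : E => u) x := fun _ => contDiffAt_const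
  exact (((((h.clm_apply (hc u)).clm_apply (hc v)).clm_apply (hc w)).sub
    (((h.clm_apply (hc v)).clm_apply (hc u)).clm_apply (hc w))).add
    ((hΓ.clm_apply (hc u)).clm_apply ((hΓ.clm_apply (hc v)).clm_apply (hc w)))).sub
    ((hΓ.clm_apply (hc v)).clm_apply ((hΓ.clm_apply (hc u)).clm_apply (hc w))) |>.neg

theorem connCurv_antisymm (Γ : E → E →L[𝕜] E →L[𝕜] E) (y u v w : E) :
    connCurv Γ y u v w = - connCurv Γ y v u w := by
  simp only [connCurv]; abel

/-- First Bianchi identity. Torsion-freeness on a neighbourhood passes to the derivative of `Γ`,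
after which all terms of the cyclic sum cancel in pairs. -/
theorem connCurv_cyclic {Γ : E → E →L[𝕜] E →L[𝕜] E} {x : E}
    (hd : DifferentiableAt 𝕜 Γ x) (hs : ∀ᶠ y in 𝓝 x, ∀ u v, Γ y u v = Γ y v u) (u v w : E) :
    connCurv Γ x u v w + connCurv Γ x v w u + connCurv Γ x w u v = 0 := by
  have hD : ∀ m u v, fderiv 𝕜 Γ x m u v = fderiv 𝕜 Γ x m v u := fun m u v => by
    rw [← fderiv_clm_apply_const₂ hd, ← fderiv_clm_apply_const₂ hd]
    exact fderiv_apply_eq_of_eventuallyEq (hs.mono fun y hy => hy u v) m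
  have hs' := hs.self_of_nhds
  simp only [connCurv]
  rw [hD u w v, hD v u w, hD w v u, hs' v w, hs' w u, hs' u v]
  abel

theorem fderiv_connCurv {Γ : E → E →L[𝕜] E →L[𝕜] E} {x : E} (hΓ : ContDiffAt 𝕜 ∞ Γ x)
    (m u v w : E) :
    fderiv 𝕜 (fun y => connCurv Γ y u v w) x m =
      -(fderiv 𝕜 (fderiv 𝕜 Γ) x m u v w - fderiv 𝕜 (fderiv 𝕜 Γ) x m v u w
        + (fderiv 𝕜 Γ x m u (Γ x v w) + Γ x u (fderiv 𝕜 Γ x m v w))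
        - (fderiv 𝕜 Γ x m v (Γ x u w) + Γ x v (fderiv 𝕜 Γ x m u w))) := by
  have h1 := hΓ.differentiableAt_infty
  have h2 := hΓ.fderiv_infty.differentiableAt_infty
  have d1 : ∀ u : E, DifferentiableAt 𝕜 (fun y => Γ y u) x := fun u => by fun_prop
  have d2 : ∀ u v : E, DifferentiableAt 𝕜 (fun y => Γ y u v) x := fun u v => by fun_prop
  have d3 : ∀ u v w : E, DifferentiableAt 𝕜 (fun y => Γ y u (Γ y v w)) x :=
    fun u v w => (d1 u).clm_apply (d2 v w)
  have e2 : ∀ u v w : E, DifferentiableAt 𝕜 (fun y => fderiv 𝕜 Γ y u v w) x :=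
    fun u v w => by fun_prop
  have k : ∀ u v w : E, fderiv 𝕜 (fun y => Γ y u (Γ y v w)) x m =
      fderiv 𝕜 Γ x m u (Γ x v w) + Γ x u (fderiv 𝕜 Γ x m v w) := fun u v w => by
    rw [fderiv_clm_apply_apply (d1 u) (d2 v w), fderiv_clm_apply_const h1,
      fderiv_clm_apply_const₂ h1]
  have k2 : ∀ u v w : E, fderiv 𝕜 (fun y => fderiv 𝕜 Γ y u v w) x m =
      fderiv 𝕜 (fderiv 𝕜 Γ) x m u v w := fun u v w => by
    rw [fderiv_clm_apply_const₂ (A := fun y => fderiv 𝕜 Γ y u)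
      (h2.clm_apply (differentiableAt_const u)),
      fderiv_clm_apply_const h2]
  unfold connCurv
  rw [fderiv_neg_apply', fderiv_sub_apply' (((e2 u v w).fun_sub (e2 v u w)).fun_add (d3 u v w))
      (d3 v u w), fderiv_add_apply' ((e2 u v w).fun_sub (e2 v u w)) (d3 u v w),
    fderiv_sub_apply' (e2 u v w) (e2 v u w), k, k, k2, k2]

/-- The second Bianchi identity. -/
theorem connCurv_bianchi {Γ : E → E →L[𝕜] E →L[𝕜] E} {x : E} (hΓ : ContDiffAt 𝕜 ∞ Γ x)
    (m u v w : E) :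
    (fderiv 𝕜 (fun y => connCurv Γ y u v w) x m + Γ x m (connCurv Γ x u v w)
        - connCurv Γ x u v (Γ x m w))
      + (fderiv 𝕜 (fun y => connCurv Γ y v m w) x u + Γ x u (connCurv Γ x v m w)
        - connCurv Γ x v m (Γ x u w))
      + (fderiv 𝕜 (fun y => connCurv Γ y m u w) x v + Γ x v (connCurv Γ x m u w)
        - connCurv Γ x m u (Γ x v w)) = 0 := by
  -- Second derivatives of `Γ` cancel by symmetry, the other terms after expanding the curvature. No
  -- Christoffel terms act on the two form arguments: the identity is d^∇R = 0, which needs no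
  -- torsion-freeness.
  have hsymm := hΓ.fderiv_fderiv_comm
  rw [fderiv_connCurv hΓ, fderiv_connCurv hΓ, fderiv_connCurv hΓ, hsymm u m, hsymm v m, hsymm v u]
  simp only [connCurv, map_neg, map_add, map_sub]
  abel

end Connection

/-! ### Connections compatible with a metric. -/

section MetricConnection

variable {𝕜 : Type*} [RCLike 𝕜] {E : Type*} [NormedAddCommGroup E] [NormedSpace 𝕜 E]
  {g : E → Bil 𝕜 E} {Γ : E → E →L[𝕜] E →L[𝕜] E} {x : E}

theorem contDiffAt_flip {X F G H : Type*} [NormedAddCommGroup X] [NormedSpace 𝕜 X]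
    [NormedAddCommGroup F] [NormedSpace 𝕜 F] [NormedAddCommGroup G] [NormedSpace 𝕜 G]
    [NormedAddCommGroup H] [NormedSpace 𝕜 H] {A : X → F →L[𝕜] G →L[𝕜] H} {x : X} {k : ℕ∞ω}
    (hA : ContDiffAt 𝕜 k A x) : ContDiffAt 𝕜 k (fun y => (A y).flip) x := by
  have := ContinuousLinearMap.contDiff (𝕜 := 𝕜) (E := F →L[𝕜] G →L[𝕜] H)
    (F := G →L[𝕜] F →L[𝕜] H) (n := k)
    (ContinuousLinearMap.flipₗᵢ 𝕜 F G H).toContinuousLinearEquiv.toContinuousLinearMap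
  exact this.contDiffAt.comp x hA

theorem contDiffAt_koszul (hg : ContDiffAt 𝕜 ∞ g x) (u v : E) :
    ContDiffAt 𝕜 ∞ (fun y => (2 : 𝕜)⁻¹ • (fderiv 𝕜 g y u v + fderiv 𝕜 g y v u
      - ((fderiv 𝕜 g y).flip u).flip v)) x := by
  have h := hg.fderiv_infty
  have hc : ∀ u : E, ContDiffAt 𝕜 ∞ (fun _ : E => u) x := fun _ => contDiffAt_const
  have h2 : ContDiffAt 𝕜 ∞ (fun y => ((fderiv 𝕜 g y).flip u).flip v) x :=
    (contDiffAt_flip ((contDiffAt_flip h).clm_apply (hc u))).clm_apply (hc v)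
  exact ContDiffAt.const_smul _ ((((h.clm_apply (hc u)).clm_apply (hc v)).add
    ((h.clm_apply (hc v)).clm_apply (hc u))).sub h2)

/-- The curvature endomorphisms of a metric connection are skew. -/
theorem apply_connCurv_skew (hΓ : ContDiffAt 𝕜 ∞ Γ x) (hg : ContDiffAt 𝕜 ∞ g x)
    (hs : ∀ᶠ y in 𝓝 x, ∀ u v, g y u v = g y v u)
    (hm : ∀ᶠ y in 𝓝 x, ∀ m u v, fderiv 𝕜 g y m u v = g y (Γ y m u) v + g y u (Γ y m v))
    (u v w t : E) :
    g x (connCurv Γ x u v w) t = - g x (connCurv Γ x u v t) w := by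
  have hΓd := hΓ.differentiableAt_infty
  have hd := hg.differentiableAt_infty
  have hf : ContDiffAt 𝕜 ∞ (fun y => g y w t) x :=
    (hg.clm_apply contDiffAt_const).clm_apply contDiffAt_const
  have dΓ : ∀ u v, DifferentiableAt 𝕜 (fun y => Γ y u v) x := fun u v =>
    (hΓd.clm_apply (differentiableAt_const u)).clm_apply (differentiableAt_const v)
  have dg : ∀ u v w, DifferentiableAt 𝕜 (fun y => g y (Γ y u v) w) x :=
    fun u v w => (hd.clm_apply (dΓ u v)).clm_apply (differentiableAt_const w)
  have hev : ∀ᶠ y in 𝓝 x, DifferentiableAt 𝕜 g y :=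
    ((hg.of_le (m := 1) (by simp)).eventually (by simp)).mono
      fun y hy => hy.differentiableAt (by simp)
  -- Metricity used twice computes the Hessian of `g(w, t)` for constant `w`, `t`. Its symmetry in
  -- `u`, `v` is the skewness of the curvature.
  have key : ∀ u v, fderiv 𝕜 (fderiv 𝕜 fun y => g y w t) x u v =
      g x (Γ x u (Γ x v w)) t + g x (Γ x v w) (Γ x u t) + g x (fderiv 𝕜 Γ x u v w) t
      + g x (Γ x u (Γ x v t)) w + g x (Γ x v t) (Γ x u w) + g x (fderiv 𝕜 Γ x u v t) w := by
    intro u v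
    have h2 : fderiv 𝕜 (fun y => fderiv 𝕜 (fun y => g y w t) y v) x u =
        fderiv 𝕜 (fun y => g y (Γ y v w) t + g y (Γ y v t) w) x u :=
      fderiv_apply_eq_of_eventuallyEq (by
        filter_upwards [hs, hm, hev] with y hs hm hd
        rw [fderiv_clm_apply_const₂ hd, hm, hs w]) u
    rw [← fderiv_clm_apply_const hf.fderiv_infty.differentiableAt_infty, h2,
      fderiv_add_apply' (dg v w t) (dg v t w),
      fderiv_clm_apply_apply₂ hd (dΓ v w) (differentiableAt_const t),
      fderiv_clm_apply_apply₂ hd (dΓ v t) (differentiableAt_const w),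
      fderiv_clm_apply_const₂ hΓd, fderiv_clm_apply_const₂ hΓd, hm.self_of_nhds,
      hm.self_of_nhds]
    simp only [fderiv_fun_const, Pi.zero_apply, zero_apply, map_zero]
    ring
  have h := key u v
  rw [hf.fderiv_fderiv_comm u v, key v u] at h
  simp only [connCurv, map_neg, map_add, map_sub, neg_apply, add_apply, sub_apply]
  rw [hs.self_of_nhds (Γ x v w) (Γ x u t), hs.self_of_nhds (Γ x v t) (Γ x u w)] at h
  linear_combination h

end MetricConnection

/-! ### The Levi-Civita connection and the symmetries of the Riemann tensor. -/

section LeviCivita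

variable {𝕜 : Type*} [RCLike 𝕜] {n : ℕ}

/-- Near `x`, `g` is a smooth field of symmetric forms that have orthonormal bases. -/
def IsMetricNear (g : Coord 𝕜 n → Bil 𝕜 (Coord 𝕜 n)) (x : Coord 𝕜 n) : Prop :=
  ∀ᶠ y in 𝓝 x, ContDiffAt 𝕜 ∞ g y ∧ (∀ u v, g y u v = g y v u) ∧
    ∃ b : Fin n → Coord 𝕜 n, IsOrthonormalFor (g y) b

variable {g : Coord 𝕜 n → Bil 𝕜 (Coord 𝕜 n)} {x : Coord 𝕜 n}

namespace IsMetricNear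

theorem eventually (hg : IsMetricNear g x) : ∀ᶠ y in 𝓝 x, IsMetricNear g y :=
  Filter.Eventually.eventually_nhds hg

theorem contDiffAt (hg : IsMetricNear g x) : ContDiffAt 𝕜 ∞ g x := hg.self_of_nhds.1

theorem symm (hg : IsMetricNear g x) (u v : Coord 𝕜 n) : g x u v = g x v u :=
  hg.self_of_nhds.2.1 u v

theorem exists_orthonormal (hg : IsMetricNear g x) :
    ∃ b : Fin n → Coord 𝕜 n, IsOrthonormalFor (g x) b := hg.self_of_nhds.2.2

theorem isInvertible (hg : IsMetricNear g x) : (g x).IsInvertible :=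
  let ⟨_, hb⟩ := hg.exists_orthonormal
  hb.isInvertible hg.symm

theorem contDiffAt_inverse (hg : IsMetricNear g x) :
    ContDiffAt 𝕜 ∞ (fun y => (g y).inverse) x :=
  hg.isInvertible.contDiffAt_map_inverse.comp x hg.contDiffAt

theorem contDiffAt_dualVec (hg : IsMetricNear g x) (i : Fin n) :
    ContDiffAt 𝕜 ∞ (fun y => dualVec (g y) i) x :=
  hg.contDiffAt_inverse.clm_apply contDiffAt_const

theorem fderiv_symm (hg : IsMetricNear g x) (m u v : Coord 𝕜 n) :
    fderiv 𝕜 g x m u v = fderiv 𝕜 g x m v u := by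
  have hd := hg.contDiffAt.differentiableAt_infty
  rw [← fderiv_clm_apply_const₂ hd, ← fderiv_clm_apply_const₂ hd]
  exact fderiv_apply_eq_of_eventuallyEq (hg.eventually.mono fun y hy => hy.symm u v) m

end IsMetricNear

/-- The Christoffel symbols as a field of bilinear maps. -/
noncomputable def christoffelBil (g : Coord 𝕜 n → Bil 𝕜 (Coord 𝕜 n)) (y : Coord 𝕜 n) :
    Coord 𝕜 n →L[𝕜] Coord 𝕜 n →L[𝕜] Coord 𝕜 n :=
  bilOfCoord (christoffel g y)

theorem christoffelBil_apply (g : Coord 𝕜 n → Bil 𝕜 (Coord 𝕜 n)) (y u v : Coord 𝕜 n) :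
    christoffelBil g y u v = christoffel g y u v := by
  refine bilOfCoord_apply (fun v => ⟨fun u u' => ?_, fun c u => ?_⟩)
    (fun u => ⟨fun v v' => ?_, fun c v => ?_⟩) u v
  -- The two homogeneity statements are proved first; the two additivity statements remain for the
  -- block below.
  iterate 2
    rotate_left
    · simp only [christoffel, ← map_smul, smul_comm c (2 : 𝕜)⁻¹]
      congr 2
      ext w
      simp
      ring
  all_goals
    simp only [christoffel, ← map_add]
    congr 2
    ext w
    simp
    ring

namespace IsMetricNear

theorem contDiffAt_christoffelBil (hg : IsMetricNear g x) :
    ContDiffAt 𝕜 ∞ (christoffelBil g) x :=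
  contDiffAt_bilOfCoord fun _ _ => hg.contDiffAt_inverse.clm_apply
    (contDiffAt_koszul hg.contDiffAt _ _)

theorem apply_christoffel (hg : IsMetricNear g x) (u v w : Coord 𝕜 n) :
    g x (christoffel g x u v) w =
      2⁻¹ * (fderiv 𝕜 g x u v w + fderiv 𝕜 g x v u w - fderiv 𝕜 g x w u v) := by
  rw [christoffel, inverse_apply_apply hg.isInvertible]
  simp

theorem christoffelBil_comm (hg : IsMetricNear g x) (u v : Coord 𝕜 n) :
    christoffelBil g x u v = christoffelBil g x v u := by
  refine eq_of_forall_apply_eq hg.isInvertible fun w => ?_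
  rw [christoffelBil_apply, christoffelBil_apply, hg.apply_christoffel, hg.apply_christoffel,
    hg.fderiv_symm w u v]
  ring

/-- The Levi-Civita connection is metric. -/
theorem fderiv_apply (hg : IsMetricNear g x) (m u v : Coord 𝕜 n) :
    fderiv 𝕜 g x m u v = g x (christoffelBil g x m u) v + g x u (christoffelBil g x m v) := by
  rw [hg.symm u, christoffelBil_apply, christoffelBil_apply, hg.apply_christoffel,
    hg.apply_christoffel, hg.fderiv_symm v m u, hg.fderiv_symm m v u, hg.fderiv_symm u m v]
  ring

/-- Through this identification the curvature identities of a general connection apply to the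
metric. -/
theorem riemann_eq (hg : IsMetricNear g x) (u v w : Coord 𝕜 n) :
    riemann g x u v w = connCurv (christoffelBil g) x u v w := by
  have hd := hg.contDiffAt_christoffelBil.differentiableAt_infty
  simp only [riemann, connCurv, ← christoffelBil_apply]
  rw [fderiv_clm_apply_const₂ hd, fderiv_clm_apply_const₂ hd]

theorem contDiffAt_riemann (hg : IsMetricNear g x) (u v w : Coord 𝕜 n) :
    ContDiffAt 𝕜 ∞ (fun y => riemann g y u v w) x :=
  (contDiffAt_connCurv hg.contDiffAt_christoffelBil u v w).congr_of_eventuallyEq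
    (hg.eventually.mono fun _ hy => hy.riemann_eq u v w)

theorem riemann_antisymm (hg : IsMetricNear g x) (u v w t : Coord 𝕜 n) :
    g x (riemann g x u v w) t = - g x (riemann g x v u w) t := by
  rw [hg.riemann_eq, hg.riemann_eq, connCurv_antisymm]
  simp

theorem riemann_skew (hg : IsMetricNear g x) (u v w t : Coord 𝕜 n) :
    g x (riemann g x u v w) t = - g x (riemann g x u v t) w := by
  rw [hg.riemann_eq, hg.riemann_eq,
    apply_connCurv_skew hg.contDiffAt_christoffelBil hg.contDiffAt
      (hg.eventually.mono fun _ hy => hy.symm) (hg.eventually.mono fun _ hy => hy.fderiv_apply)]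

theorem riemann_cyclic (hg : IsMetricNear g x) (u v w t : Coord 𝕜 n) :
    g x (riemann g x u v w) t + g x (riemann g x v w u) t + g x (riemann g x w u v) t = 0 := by
  have h := connCurv_cyclic hg.contDiffAt_christoffelBil.differentiableAt_infty
    (hg.eventually.mono fun y hy => hy.christoffelBil_comm) u v w
  rw [← hg.riemann_eq, ← hg.riemann_eq, ← hg.riemann_eq] at h
  rw [← add_apply, ← add_apply, ← map_add, ← map_add, h]
  simp

/-- The octahedron argument: four first Bianchi identities, for the cyclic rotations of the
arguments, are combined with signs +, +, -, -. The skew symmetries cancel everything except twice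
the difference of the two sides. -/
theorem riemann_pair_symm (hg : IsMetricNear g x) (u v w t : Coord 𝕜 n) :
    g x (riemann g x u v w) t = g x (riemann g x w t u) v := by
  have c1 := hg.riemann_cyclic u v w t
  have c2 := hg.riemann_cyclic v w t u
  have c3 := hg.riemann_cyclic w t u v
  have c4 := hg.riemann_cyclic t u v w
  have s1 := hg.riemann_skew v w t u
  have s2 := hg.riemann_skew w t v u
  have s3 := hg.riemann_skew t u v w
  have s4 := hg.riemann_skew u v t w
  have s5 := (hg.riemann_skew u w t v).trans (congrArg Neg.neg (hg.riemann_antisymm u w v t))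
  have s6 := (hg.riemann_skew v t u w).trans (congrArg Neg.neg (hg.riemann_antisymm v t w u))
  linear_combination (1 / 2) * (c1 + c2 - c3 - c4 - s1 - s2 + s3 + s4 + s5 + s6)

theorem isQuadrilinear_riemann (hg : IsMetricNear g x) :
    IsQuadrilinear fun u v w t => g x (riemann g x u v w) t := by
  simp_rw [hg.riemann_eq, connCurv]
  constructor <;> intros <;> constructor <;> intros <;>
    simp only [map_neg, map_add, map_sub, map_smul, neg_apply, add_apply, sub_apply, smul_apply,
      smul_eq_mul] <;> ring

/-- The second Bianchi identity for the covariant curvature tensor. -/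
theorem riemann_bianchi (hg : IsMetricNear g x) (m u v w t : Coord 𝕜 n) :
    (fderiv 𝕜 (fun y => g y (riemann g y u v w) t) x m
        - g x (riemann g x u v (christoffel g x m w)) t
        - g x (riemann g x u v w) (christoffel g x m t))
      + (fderiv 𝕜 (fun y => g y (riemann g y v m w) t) x u
        - g x (riemann g x v m (christoffel g x u w)) t
        - g x (riemann g x v m w) (christoffel g x u t))
      + (fderiv 𝕜 (fun y => g y (riemann g y m u w) t) x v
        - g x (riemann g x m u (christoffel g x v w)) t
        - g x (riemann g x m u w) (christoffel g x v t)) = 0 := by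
  have hd := hg.contDiffAt.differentiableAt_infty
  have key : ∀ m u v, fderiv 𝕜 (fun y => g y (riemann g y u v w) t) x m =
      g x (christoffelBil g x m (riemann g x u v w)) t
        + g x (riemann g x u v w) (christoffel g x m t)
        + g x (fderiv 𝕜 (fun y => connCurv (christoffelBil g) y u v w) x m) t := by
    intro m u v
    rw [fderiv_clm_apply_apply₂ hd (hg.contDiffAt_riemann u v w).differentiableAt_infty
      (differentiableAt_const t), hg.fderiv_apply, christoffelBil_apply g x m t,
      fderiv_apply_eq_of_eventuallyEq (hg.eventually.mono fun y hy => hy.riemann_eq u v w) m]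
    simp
  have h := congrArg (fun z => g x z t)
    (connCurv_bianchi hg.contDiffAt_christoffelBil m u v w)
  simp only [map_add, map_sub, add_apply, sub_apply, map_zero, zero_apply] at h
  rw [key, key, key]
  simp only [hg.riemann_eq, christoffelBil_apply] at h ⊢
  linear_combination h

end IsMetricNear

end LeviCivita

/-! ### Ricci and Weyl tensors; self-dual Weyl tensors. -/

section Weyl

variable {𝕜 : Type*} [RCLike 𝕜] {n : ℕ}

theorem IsOrthonormalFor.sum_coordVec_dualVec_of_isLinearMap {β : Bil 𝕜 (Coord 𝕜 n)}
    {b : Fin n → Coord 𝕜 n} (hb : IsOrthonormalFor β b) (hs : ∀ u v, β u v = β v u)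
    {f : Coord 𝕜 n → Coord 𝕜 n → 𝕜} (h₁ : ∀ v, IsLinearMap 𝕜 fun u => f u v)
    (h₂ : ∀ u, IsLinearMap 𝕜 (f u)) :
    ∑ i, f (coordVec 𝕜 i) (dualVec β i) = ∑ a, f (b a) (b a) :=
  hb.sum_coordVec_dualVec hs (LinearMap.mk₂ 𝕜 f (fun u u' v => (h₁ v).map_add u u')
    (fun c u v => (h₁ v).map_smul c u) (fun u v v' => (h₂ u).map_add v v')
    (fun c u v => (h₂ u).map_smul c v))

theorem isLinearMap_clm {F : Type*} [NormedAddCommGroup F] [NormedSpace 𝕜 F]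
    (f : Coord 𝕜 n →L[𝕜] F) : IsLinearMap 𝕜 fun u => f u := ⟨by simp, by simp⟩

theorem isLinearMap_clm_left (f : Bil 𝕜 (Coord 𝕜 n)) (v : Coord 𝕜 n) :
    IsLinearMap 𝕜 fun u => f u v := ⟨by simp, by simp⟩

theorem isLinearMap_sum {ι E : Type*} [AddCommGroup E] [Module 𝕜 E] {s : Finset ι}
    {f : ι → E → 𝕜} (h : ∀ i ∈ s, IsLinearMap 𝕜 (f i)) : IsLinearMap 𝕜 fun u => ∑ i ∈ s, f i u where
  map_add u v := by
    rw [← Finset.sum_add_distrib]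
    exact Finset.sum_congr rfl fun i hi => (h i hi).map_add u v
  map_smul c u := by
    rw [Finset.smul_sum]
    exact Finset.sum_congr rfl fun i hi => (h i hi).map_smul c u

variable {g : Coord 𝕜 n → Bil 𝕜 (Coord 𝕜 n)} {x : Coord 𝕜 n}

/-- The normalized Ricci tensor as a field of bilinear forms. -/
noncomputable def normRicciBil (g : Coord 𝕜 n → Bil 𝕜 (Coord 𝕜 n)) (y : Coord 𝕜 n) :
    Bil 𝕜 (Coord 𝕜 n) :=
  bilOfCoord (normRicci g y)

/-- The Ricci tensor as a field of bilinear forms. -/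
noncomputable def ricciBil (g : Coord 𝕜 n → Bil 𝕜 (Coord 𝕜 n)) (y : Coord 𝕜 n) :
    Bil 𝕜 (Coord 𝕜 n) :=
  bilOfCoord (ricci g y)

namespace IsMetricNear

/-- The i-th coordinate of a vector is its pairing with `dualVec (g x) i`, so the coordinate trace
is a metric contraction and can be taken in any orthonormal basis. -/
theorem ricci_eq (hg : IsMetricNear g x) {b : Fin n → Coord 𝕜 n} (hb : IsOrthonormalFor (g x) b)
    (u v : Coord 𝕜 n) : ricci g x u v = ∑ a, g x (riemann g x u (b a) v) (b a) := by
  have hQ := hg.isQuadrilinear_riemann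
  rw [← hb.sum_coordVec_dualVec_of_isLinearMap hg.symm (f := fun w t => g x (riemann g x u w v) t)
    (fun t => hQ.snd u v t) (fun w => hQ.fth u w v)]
  refine Finset.sum_congr rfl fun i _ => ?_
  rw [hg.symm, apply_dualVec hg.isInvertible]

theorem ricci_symm (hg : IsMetricNear g x) (u v : Coord 𝕜 n) :
    ricci g x u v = ricci g x v u := by
  obtain ⟨b, hb⟩ := hg.exists_orthonormal
  rw [hg.ricci_eq hb, hg.ricci_eq hb]
  exact Finset.sum_congr rfl fun a _ => hg.riemann_pair_symm _ _ _ _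

theorem ricciBil_apply (hg : IsMetricNear g x) (u v : Coord 𝕜 n) :
    ricciBil g x u v = ricci g x u v := by
  obtain ⟨b, hb⟩ := hg.exists_orthonormal
  have hQ := hg.isQuadrilinear_riemann
  refine bilOfCoord_apply (fun v => ?_) (fun u => ?_) u v
  · simp_rw [hg.ricci_eq hb]
    exact isLinearMap_sum fun a _ => hQ.fst (b a) v (b a)
  · simp_rw [funext (hg.ricci_eq hb u)]
    exact isLinearMap_sum fun a _ => hQ.trd u (b a) (b a)

theorem scal_eq (hg : IsMetricNear g x) {b : Fin n → Coord 𝕜 n} (hb : IsOrthonormalFor (g x) b) :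
    scal g x = ∑ a, ricci g x (b a) (b a) := by
  simp_rw [scal, ← hg.ricciBil_apply]
  exact hb.sum_coordVec_dualVec_of_isLinearMap hg.symm (isLinearMap_clm_left _)
    fun u => isLinearMap_clm _

theorem normRicciBil_apply (hg : IsMetricNear g x) (u v : Coord 𝕜 n) :
    normRicciBil g x u v = normRicci g x u v := by
  refine bilOfCoord_apply (fun v => ?_) (fun u => ?_) u v
  on_goal 2 => change IsLinearMap 𝕜 fun v => normRicci g x u v
  all_goals
    simp only [normRicci, ← hg.ricciBil_apply]
    constructor <;> intros <;>
      simp only [map_add, map_smul, add_apply, smul_apply, smul_eq_mul] <;> ring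

theorem normRicci_symm (hg : IsMetricNear g x) (u v : Coord 𝕜 n) :
    normRicciBil g x u v = normRicciBil g x v u := by
  rw [hg.normRicciBil_apply, hg.normRicciBil_apply, normRicci, normRicci, hg.symm u, hg.ricci_symm u]

theorem contDiffAt_ricci (hg : IsMetricNear g x) (u v : Coord 𝕜 n) :
    ContDiffAt 𝕜 ∞ (fun y => ricci g y u v) x :=
  ContDiffAt.sum fun i _ => (contDiffAt_const
    (c := (EuclideanSpace.proj i : Coord 𝕜 n →L[𝕜] 𝕜))).clm_apply (hg.contDiffAt_riemann _ _ _)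

theorem contDiffAt_scal (hg : IsMetricNear g x) : ContDiffAt 𝕜 ∞ (scal g) x := by
  have h : ContDiffAt 𝕜 ∞ (ricciBil g) x := contDiffAt_bilOfCoord fun _ _ => hg.contDiffAt_ricci _ _
  have h2 : ContDiffAt 𝕜 ∞ (fun y => ∑ i, ricciBil g y (coordVec 𝕜 i) (dualVec (g y) i)) x :=
    ContDiffAt.sum fun i _ => (h.clm_apply contDiffAt_const).clm_apply (hg.contDiffAt_dualVec i)
  refine h2.congr_of_eventuallyEq (hg.eventually.mono fun y hy => ?_)
  simp_rw [hy.ricciBil_apply]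
  rfl

theorem contDiffAt_apply (hg : IsMetricNear g x) (u v : Coord 𝕜 n) :
    ContDiffAt 𝕜 ∞ (fun y => g y u v) x :=
  (hg.contDiffAt.clm_apply contDiffAt_const).clm_apply contDiffAt_const

theorem contDiffAt_normRicci (hg : IsMetricNear g x) (u v : Coord 𝕜 n) :
    ContDiffAt 𝕜 ∞ (fun y => normRicci g y u v) x :=
  ((hg.contDiffAt_scal.div_const _).mul (hg.contDiffAt_apply u v)).add
    (contDiffAt_const.mul ((hg.contDiffAt_ricci u v).sub
      ((hg.contDiffAt_scal.div_const _).mul (hg.contDiffAt_apply u v))))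

theorem contDiffAt_normRicciBil (hg : IsMetricNear g x) : ContDiffAt 𝕜 ∞ (normRicciBil g) x :=
  contDiffAt_bilOfCoord fun _ _ => hg.contDiffAt_normRicci _ _

theorem contDiffAt_weyl (hg : IsMetricNear g x) (u v w t : Coord 𝕜 n) :
    ContDiffAt 𝕜 ∞ (fun y => weyl g y u v w t) x := by
  have h := hg.contDiffAt_normRicci
  have k := hg.contDiffAt_apply
  exact ((hg.contDiffAt.clm_apply (hg.contDiffAt_riemann u v w)).clm_apply contDiffAt_const).sub
    ((((h u w).mul (k v t)).sub ((k v w).mul (h u t))).sub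
      (((h v w).mul (k u t)).sub ((k u w).mul (h v t))))

theorem weyl_eq (hg : IsMetricNear g x) (u v w t : Coord 𝕜 n) :
    weyl g x u v w t = g x (riemann g x u v w) t
      - (normRicciBil g x u w * g x v t - g x v w * normRicciBil g x u t
        - (normRicciBil g x v w * g x u t - g x u w * normRicciBil g x v t)) := by
  simp only [weyl, hg.normRicciBil_apply]

theorem isQuadrilinear_weyl (hg : IsMetricNear g x) : IsQuadrilinear (weyl g x) := by
  obtain ⟨T, hT⟩ := hg.isQuadrilinear_riemann.exists_linearMap
  have h : weyl g x = fun u v w t => T u v w t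
      - (normRicciBil g x u w * g x v t - g x v w * normRicciBil g x u t
        - (normRicciBil g x v w * g x u t - g x u w * normRicciBil g x v t)) := by
    funext u v w t
    rw [hg.weyl_eq, hT]
  rw [h]
  constructor <;> intros <;> constructor <;> intros <;>
    simp only [map_add, map_smul, add_apply, smul_apply, smul_eq_mul, LinearMap.add_apply,
      LinearMap.smul_apply] <;> ring

theorem weyl_antisymm (hg : IsMetricNear g x) (u v w t : Coord 𝕜 n) :
    weyl g x u v w t = - weyl g x v u w t := by
  rw [hg.weyl_eq, hg.weyl_eq, hg.riemann_antisymm u v]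
  ring

theorem weyl_pair_symm (hg : IsMetricNear g x) (u v w t : Coord 𝕜 n) :
    weyl g x u v w t = weyl g x w t u v := by
  rw [hg.weyl_eq, hg.weyl_eq, hg.riemann_pair_symm u v w t]
  simp only [hg.symm w, hg.symm t, hg.normRicci_symm w, hg.normRicci_symm t]
  ring

end IsMetricNear

/-- Here the normalization of h matters: in dimension four the contraction of h ∧ I is 2h + (tr h)
g, where tr h = Scal/6, and this sum is Ric. -/
theorem IsMetricNear.weyl_trace {g : Coord 𝕜 4 → Bil 𝕜 (Coord 𝕜 4)} {x : Coord 𝕜 4}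
    (hg : IsMetricNear g x) (v t : Coord 𝕜 4) :
    ∑ i, weyl g x (coordVec 𝕜 i) v (dualVec (g x) i) t = 0 := by
  obtain ⟨b, hb⟩ := hg.exists_orthonormal
  have hQ := hg.isQuadrilinear_weyl
  rw [hb.sum_coordVec_dualVec_of_isLinearMap hg.symm (f := fun u w => weyl g x u v w t)
    (fun w => hQ.fst v w t) (fun u => hQ.trd u v t)]
  have h1 : ∑ a, g x (riemann g x (b a) v (b a)) t = ricci g x v t := by
    rw [hg.ricci_eq hb]
    refine Finset.sum_congr rfl fun a _ => ?_
    rw [hg.riemann_antisymm, hg.riemann_skew, neg_neg]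
  have h2 : ∑ a, g x v (b a) * normRicciBil g x (b a) t = normRicciBil g x v t := by
    conv_rhs => rw [hb.sum_repr v]
    simp [hg.symm v]
  have h3 : ∑ a, normRicciBil g x v (b a) * g x (b a) t = normRicciBil g x v t := by
    conv_rhs => rw [hb.sum_repr t]
    simp [mul_comm]
  have h4 : ∑ a, normRicciBil g x (b a) (b a) = scal g x / 6 := by
    simp only [hg.normRicciBil_apply, normRicci, Finset.sum_add_distrib, ← Finset.mul_sum,
      Finset.sum_sub_distrib, ← hg.scal_eq hb, hb _ _, if_true]
    simp
    ring
  simp only [hg.weyl_eq, Finset.sum_sub_distrib, h1, h2, h3, ← Finset.sum_mul, h4, hb _ _, if_true]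
  rw [hg.normRicciBil_apply, normRicci]
  simp
  ring

/-- The algebraic properties of a self-dual Weyl tensor. -/
structure IsSelfDualWeyl (β : Bil 𝕜 (Coord 𝕜 4)) (vol : Coord 𝕜 4 [⋀^Fin 4]→L[𝕜] 𝕜)
    (T : Coord 𝕜 4 → Coord 𝕜 4 → Coord 𝕜 4 → Coord 𝕜 4 → 𝕜) : Prop where
  quad : IsQuadrilinear T
  antisymm : ∀ u v w t, T u v w t = - T v u w t
  pair_symm : ∀ u v w t, T u v w t = T w t u v
  trace : ∀ v t, ∑ i, T (coordVec 𝕜 i) v (dualVec β i) t = 0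
  star : ∀ u v w t, T u v w t = 1 / 2 * ∑ i, ∑ j, vol ![u, v, coordVec 𝕜 i, coordVec 𝕜 j]
    * T (dualVec β i) (dualVec β j) w t

variable {g : Coord 𝕜 4 → Bil 𝕜 (Coord 𝕜 4)} {vol : Coord 𝕜 4 → Coord 𝕜 4 [⋀^Fin 4]→L[𝕜] 𝕜}
  {x : Coord 𝕜 4}

theorem weyl_eq_weylStar (h : ∀ u v w t, weylMinus g vol x u v w t = 0) (u v w t : Coord 𝕜 4) :
    weyl g x u v w t = weylStar g vol x u v w t := by
  have := h u v w t
  rw [weylMinus] at this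
  linear_combination 2 * this

theorem weylPlus_eq_weyl (h : ∀ u v w t, weylMinus g vol x u v w t = 0) (u v w t : Coord 𝕜 4) :
    weylPlus g vol x u v w t = weyl g x u v w t := by
  rw [weylPlus, ← weyl_eq_weylStar h]
  ring

/-- Self-duality near `x` makes W⁺ equal to W as germs, and the connection terms are values of W at
`x`, hence zero. -/
theorem covDeriv_weylPlus_eq
    (h : ∀ᶠ y in 𝓝 x, ∀ u v w t, weylMinus g vol y u v w t = 0)
    (h0 : ∀ u v w t, weyl g x u v w t = 0) (m u v w t : Coord 𝕜 4) :
    covDeriv g (weylPlus g vol) x m u v w t = fderiv 𝕜 (fun y => weyl g y u v w t) x m := by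
  have h1 : ∀ u v w t, weylPlus g vol x u v w t = 0 := fun u v w t => by
    rw [weylPlus_eq_weyl h.self_of_nhds, h0]
  rw [covDeriv, h1, h1, h1, h1, fderiv_apply_eq_of_eventuallyEq
    (h.mono fun y hy => weylPlus_eq_weyl hy u v w t)]
  ring

theorem IsMetricNear.isSelfDualWeyl_weyl (hg : IsMetricNear g x)
    (h : ∀ u v w t, weylMinus g vol x u v w t = 0) : IsSelfDualWeyl (g x) (vol x) (weyl g x) where
  quad := hg.isQuadrilinear_weyl
  antisymm := hg.weyl_antisymm
  pair_symm := hg.weyl_pair_symm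
  trace := hg.weyl_trace
  star := weyl_eq_weylStar h

theorem fderiv_mul_of_eq_zero {E : Type*} [NormedAddCommGroup E] [NormedSpace 𝕜 E] {c f : E → 𝕜}
    {x : E} (hc : DifferentiableAt 𝕜 c x) (hf : DifferentiableAt 𝕜 f x) (h0 : f x = 0) (m : E) :
    fderiv 𝕜 (fun y => c y * f y) x m = c x * fderiv 𝕜 f x m := by
  rw [fderiv_mul_apply' hc hf, h0]
  ring

/-- The derivative, at a zero of the Weyl tensor, of the Weyl tensor of a self-dual metric is a
self-dual Weyl tensor. -/
theorem IsMetricNear.isSelfDualWeyl_fderiv_weyl (hg : IsMetricNear g x)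
    (hvol : ContDiffAt 𝕜 ∞ vol x) (h : ∀ᶠ y in 𝓝 x, ∀ u v w t, weylMinus g vol y u v w t = 0)
    (h0 : ∀ u v w t, weyl g x u v w t = 0) (m : Coord 𝕜 4) :
    IsSelfDualWeyl (g x) (vol x) fun u v w t => fderiv 𝕜 (fun y => weyl g y u v w t) x m := by
  have hd : ∀ u v w t, DifferentiableAt 𝕜 (fun y => weyl g y u v w t) x := fun u v w t =>
    (hg.contDiffAt_weyl u v w t).differentiableAt_infty
  have hdual : ∀ i j, DifferentiableAt 𝕜 (fun y => dualVec (g y) i j) x := fun i j =>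
    ((contDiffAt_const (c := (EuclideanSpace.proj j : Coord 𝕜 4 →L[𝕜] 𝕜))).clm_apply
      (hg.contDiffAt_dualVec i)).differentiableAt_infty
  have hvd : ∀ z, DifferentiableAt 𝕜 (fun y => vol y z) x := fun z =>
    ((contDiffAt_const (c := ContinuousAlternatingMap.apply 𝕜 (Coord 𝕜 4) 𝕜 z)).clm_apply
      hvol).differentiableAt_infty
  have hquad := isQuadrilinear_fderiv (hg.eventually.mono fun y hy => hy.isQuadrilinear_weyl) hd m
  refine ⟨hquad, fun u v w t => ?_, fun u v w t => ?_, fun v t => ?_, fun u v w t => ?_⟩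
  · rw [← fderiv_neg_apply']
    exact fderiv_apply_eq_of_eventuallyEq (hg.eventually.mono fun y hy => hy.weyl_antisymm u v w t) m
  · exact fderiv_apply_eq_of_eventuallyEq (hg.eventually.mono fun y hy => hy.weyl_pair_symm u v w t) m
  · have h1 : ∀ᶠ y in 𝓝 x,
        ∑ i, ∑ j, dualVec (g y) i j * weyl g y (coordVec 𝕜 i) v (coordVec 𝕜 j) t = 0 := by
      filter_upwards [hg.eventually] with y hy
      rw [← hy.weyl_trace v t]
      refine Finset.sum_congr rfl fun i _ => ?_
      exact ((hy.isQuadrilinear_weyl.trd _ v t).eq_sum_coordVec (dualVec (g y) i)).symm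
    have h2 := fderiv_apply_eq_of_eventuallyEq (𝕜 := 𝕜) h1 m
    have hp : ∀ i j, DifferentiableAt 𝕜
        (fun y => dualVec (g y) i j * weyl g y (coordVec 𝕜 i) v (coordVec 𝕜 j) t) x :=
      fun i j => (hdual i j).fun_mul (hd _ _ _ _)
    rw [fderiv_sum_apply' (fun i _ => DifferentiableAt.fun_sum fun j _ => hp i j) m] at h2
    simp only [fderiv_fun_const, Pi.zero_apply, zero_apply] at h2
    rw [← h2]
    refine Finset.sum_congr rfl fun i _ => ?_
    rw [fderiv_sum_apply' fun j _ => hp i j,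
      (hquad.trd _ v t).eq_sum_coordVec (dualVec (g x) i)]
    refine Finset.sum_congr rfl fun j _ => ?_
    rw [fderiv_mul_of_eq_zero (hdual i j) (hd _ _ _ _) (h0 _ _ _ _), smul_eq_mul]
  -- Same device for self-duality: the volume form and both dual vectors go into the coefficient,
  -- and only the Weyl component is differentiated at `x`.
  · have h1 : ∀ᶠ y in 𝓝 x, weyl g y u v w t = ∑ i, ∑ j, ∑ k, ∑ l,
        (1 / 2 * vol y ![u, v, coordVec 𝕜 i, coordVec 𝕜 j] * dualVec (g y) i k * dualVec (g y) j l)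
          * weyl g y (coordVec 𝕜 k) (coordVec 𝕜 l) w t := by
      filter_upwards [hg.eventually, h] with y hy hy'
      rw [weyl_eq_weylStar hy', weylStar, Finset.mul_sum]
      refine Finset.sum_congr rfl fun i _ => ?_
      rw [Finset.mul_sum]
      refine Finset.sum_congr rfl fun j _ => ?_
      rw [(hy.isQuadrilinear_weyl.fst _ w t).eq_sum_coordVec (dualVec (g y) i), Finset.mul_sum,
        Finset.mul_sum]
      refine Finset.sum_congr rfl fun k _ => ?_
      rw [(hy.isQuadrilinear_weyl.snd _ w t).eq_sum_coordVec (dualVec (g y) j), Finset.smul_sum,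
        Finset.mul_sum, Finset.mul_sum]
      refine Finset.sum_congr rfl fun l _ => ?_
      simp only [smul_eq_mul]
      ring
    have hc : ∀ i j k l, DifferentiableAt 𝕜 (fun y => 1 / 2
        * vol y ![u, v, coordVec 𝕜 i, coordVec 𝕜 j] * dualVec (g y) i k * dualVec (g y) j l) x :=
      fun i j k l => (((hvd _).const_mul _).fun_mul (hdual i k)).fun_mul (hdual j l)
    have hp : ∀ i j k l, DifferentiableAt 𝕜 (fun y => (1 / 2
        * vol y ![u, v, coordVec 𝕜 i, coordVec 𝕜 j] * dualVec (g y) i k * dualVec (g y) j l)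
        * weyl g y (coordVec 𝕜 k) (coordVec 𝕜 l) w t) x :=
      fun i j k l => (hc i j k l).fun_mul (hd _ _ _ _)
    rw [fderiv_apply_eq_of_eventuallyEq h1 m, fderiv_sum_apply' fun i _ =>
      DifferentiableAt.fun_sum fun j _ => DifferentiableAt.fun_sum fun k _ =>
      DifferentiableAt.fun_sum fun l _ => hp i j k l, Finset.mul_sum]
    refine Finset.sum_congr rfl fun i _ => ?_
    rw [fderiv_sum_apply' fun j _ => DifferentiableAt.fun_sum fun k _ =>
      DifferentiableAt.fun_sum fun l _ => hp i j k l, Finset.mul_sum]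
    refine Finset.sum_congr rfl fun j _ => ?_
    rw [fderiv_sum_apply' fun k _ =>
      DifferentiableAt.fun_sum fun l _ => hp i j k l,
      (hquad.fst _ w t).eq_sum_coordVec (dualVec (g x) i), Finset.mul_sum, Finset.mul_sum]
    refine Finset.sum_congr rfl fun k _ => ?_
    rw [fderiv_sum_apply' fun l _ => hp i j k l,
      (hquad.snd _ w t).eq_sum_coordVec (dualVec (g x) j), Finset.smul_sum,
      Finset.mul_sum, Finset.mul_sum]
    refine Finset.sum_congr rfl fun l _ => ?_
    rw [fderiv_mul_of_eq_zero (hc i j k l) (hd _ _ _ _) (h0 _ _ _ _)]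
    simp only [smul_eq_mul]
    ring

end Weyl

/-! ### The Cotton-York tensor and the Bianchi identity for the Weyl tensor. -/

section Bianchi

variable {𝕜 : Type*} [RCLike 𝕜] {n : ℕ} {g : Coord 𝕜 n → Bil 𝕜 (Coord 𝕜 n)} {x : Coord 𝕜 n}

namespace IsMetricNear

/-- The terms in which the connection acts on the differentiated pair, h(Γ(u,v), w) and h(Γ(v,u),
w), cancel since Γ is symmetric. -/
theorem cotton_eq (hg : IsMetricNear g x) (u v w : Coord 𝕜 n) :
    cotton g x u v w = fderiv 𝕜 (normRicciBil g) x u v w - fderiv 𝕜 (normRicciBil g) x v u w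
      - normRicciBil g x v (christoffelBil g x u w)
      + normRicciBil g x u (christoffelBil g x v w) := by
  have hd := hg.contDiffAt_normRicciBil.differentiableAt_infty
  have h : ∀ v w u, fderiv 𝕜 (fun y => normRicci g y v w) x u =
      fderiv 𝕜 (normRicciBil g) x u v w := fun v w u => by
    rw [← fderiv_clm_apply_const₂ hd]
    exact fderiv_apply_eq_of_eventuallyEq
      (hg.eventually.mono fun y hy => (hy.normRicciBil_apply v w).symm) u
  rw [cotton, h, h]
  simp only [← hg.normRicciBil_apply, ← christoffelBil_apply]
  rw [hg.christoffelBil_comm v u]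
  ring

theorem cotton_antisymm (hg : IsMetricNear g x) (u v w : Coord 𝕜 n) :
    cotton g x u v w = - cotton g x v u w := by
  rw [hg.cotton_eq, hg.cotton_eq]
  ring

set_option maxHeartbeats 1000000 in
/-- The Bianchi identity for the Weyl tensor at one of its zeros. -/
theorem weyl_bianchi (hg : IsMetricNear g x) (h0 : ∀ u v w t, weyl g x u v w t = 0)
    (m u v w t : Coord 𝕜 n) :
    fderiv 𝕜 (fun y => weyl g y u v w t) x m + fderiv 𝕜 (fun y => weyl g y v m w t) x u
      + fderiv 𝕜 (fun y => weyl g y m u w t) x v =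
      -(cotton g x m u w * g x v t - cotton g x m u t * g x v w
        + cotton g x u v w * g x m t - cotton g x u v t * g x m w
        + cotton g x v m w * g x u t - cotton g x v m t * g x u w) := by
  have hd := hg.contDiffAt.differentiableAt_infty
  have hh := hg.contDiffAt_normRicciBil.differentiableAt_infty
  have dg : ∀ u v, DifferentiableAt 𝕜 (fun y => g y u v) x := fun u v =>
    (hg.contDiffAt_apply u v).differentiableAt_infty
  have dh : ∀ u v, DifferentiableAt 𝕜 (fun y => normRicciBil g y u v) x := fun u v =>
    (hh.clm_apply (differentiableAt_const u)).clm_apply (differentiableAt_const v)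
  have dW : ∀ u v, DifferentiableAt 𝕜 (fun y => weyl g y u v w t) x := fun u v =>
    (hg.contDiffAt_weyl u v w t).differentiableAt_infty
  have hprod : ∀ a b c d m, fderiv 𝕜 (fun y => normRicciBil g y a b * g y c d) x m =
      fderiv 𝕜 (normRicciBil g) x m a b * g x c d + normRicciBil g x a b *
        (g x (christoffelBil g x m c) d + g x (christoffelBil g x m d) c) := fun a b c d m => by
    rw [fderiv_mul_apply' (dh a b) (dg c d), fderiv_clm_apply_const₂ hd,
      fderiv_clm_apply_const₂ hh, hg.fderiv_apply, hg.symm c (christoffelBil g x m d)]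
  have hR : ∀ m u v, fderiv 𝕜 (fun y => g y (riemann g y u v w) t) x m =
      fderiv 𝕜 (fun y => weyl g y u v w t) x m
      + (fderiv 𝕜 (fun y => normRicciBil g y u w * g y v t) x m
        - fderiv 𝕜 (fun y => normRicciBil g y u t * g y v w) x m
        - (fderiv 𝕜 (fun y => normRicciBil g y v w * g y u t) x m
          - fderiv 𝕜 (fun y => normRicciBil g y v t * g y u w) x m)) := fun m u v => by
    have d1 := (dh u w).fun_mul (dg v t)
    have d2 := (dh u t).fun_mul (dg v w)
    have d3 := (dh v w).fun_mul (dg u t)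
    have d4 := (dh v t).fun_mul (dg u w)
    rw [← fderiv_sub_apply' d1 d2, ← fderiv_sub_apply' d3 d4,
      ← fderiv_sub_apply' (d1.fun_sub d2) (d3.fun_sub d4),
      ← fderiv_add_apply' (dW u v) ((d1.fun_sub d2).fun_sub (d3.fun_sub d4))]
    exact fderiv_apply_eq_of_eventuallyEq
      (hg.eventually.mono fun y hy => by rw [hy.weyl_eq]; ring) m
  -- At `x` the curvature is h ∧ I. Hence the connection terms of the second Bianchi identity
  -- involve only h, g and Γ; together with the derivatives of h ∧ I they assemble into Cotton-York
  -- terms.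
  have hR0 : ∀ u v w t, g x (riemann g x u v w) t =
      normRicciBil g x u w * g x v t - g x v w * normRicciBil g x u t
        - (normRicciBil g x v w * g x u t - g x u w * normRicciBil g x v t) := fun u v w t => by
    have := h0 u v w t
    rw [hg.weyl_eq] at this
    linear_combination this
  have hB := hg.riemann_bianchi m u v w t
  simp only [hR, hR0, hprod, ← christoffelBil_apply] at hB
  simp only [hg.cotton_eq]
  rw [hg.christoffelBil_comm u m, hg.christoffelBil_comm v m, hg.christoffelBil_comm v u] at hB
  simp only [fun a b c => hg.symm a (christoffelBil g x b c)] at hB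
  linear_combination hB

end IsMetricNear

end Bianchi

/-! ### Self-dual Weyl tensors in a basis adapted to a hyperplane. -/

section AdaptedBasis

variable {𝕜 : Type*} [RCLike 𝕜] {β : Bil 𝕜 (Coord 𝕜 4)} {vol : Coord 𝕜 4 [⋀^Fin 4]→L[𝕜] 𝕜}
  {T : Coord 𝕜 4 → Coord 𝕜 4 → Coord 𝕜 4 → Coord 𝕜 4 → 𝕜}
  {L : Coord 𝕜 3 →L[𝕜] Coord 𝕜 4} {e : Fin 3 → Coord 𝕜 3} {ν : Coord 𝕜 4}

theorem isLinearMap_volume_third (vol : Coord 𝕜 4 [⋀^Fin 4]→L[𝕜] 𝕜) (u v t : Coord 𝕜 4) :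
    IsLinearMap 𝕜 fun z => vol ![u, v, z, t] := by
  have h : ∀ z, ![u, v, z, t] = Function.update ![u, v, 0, t] 2 z := fun z => by
    funext i
    fin_cases i <;> rfl
  constructor
  · intro z z'
    rw [h (z + z'), vol.map_update_add, ← h, ← h]
  · intro c z
    rw [h (c • z), vol.map_update_smul, ← h]

theorem isLinearMap_volume_fourth (vol : Coord 𝕜 4 [⋀^Fin 4]→L[𝕜] 𝕜) (u v w : Coord 𝕜 4) :
    IsLinearMap 𝕜 fun z => vol ![u, v, w, z] := by
  have h : ∀ z, ![u, v, w, z] = Function.update ![u, v, w, 0] 3 z := fun z => by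
    funext i
    fin_cases i <;> rfl
  constructor
  · intro z z'
    rw [h (z + z'), vol.map_update_add, ← h, ← h]
  · intro c z
    rw [h (c • z), vol.map_update_smul, ← h]

theorem volume_eq_zero_of_range (vol : Coord 𝕜 4 [⋀^Fin 4]→L[𝕜] 𝕜)
    (L : Coord 𝕜 3 →L[𝕜] Coord 𝕜 4) (X Y Z T : Coord 𝕜 3) : vol ![L X, L Y, L Z, L T] = 0 := by
  have h : ¬ LinearIndependent 𝕜 ![X, Y, Z, T] := fun h => by
    have := h.fintype_card_le_finrank
    simp at this
  have h2 := (vol.toAlternatingMap.compLinearMap (L : Coord 𝕜 3 →ₗ[𝕜] Coord 𝕜 4)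
    ).map_linearDependent _ h
  refine Eq.trans (congrArg vol ?_) h2
  funext i
  fin_cases i <;> rfl

theorem volume_swap (vol : Coord 𝕜 4 [⋀^Fin 4]→L[𝕜] 𝕜) (u v z z' : Coord 𝕜 4) :
    vol ![u, v, z, z'] = - vol ![u, v, z', z] := by
  have h := vol.toAlternatingMap.map_swap ![u, v, z', z] (show (2 : Fin 4) ≠ 3 by decide)
  refine Eq.trans (congrArg vol ?_) h
  funext i
  fin_cases i <;> rfl

theorem volume_self (vol : Coord 𝕜 4 [⋀^Fin 4]→L[𝕜] 𝕜) (u v z : Coord 𝕜 4) :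
    vol ![u, v, z, z] = 0 :=
  vol.map_eq_zero_of_eq _ (i := 2) (j := 3) rfl (by decide)

/-- Each of the two sums pairs coordinate vectors with their metric duals in a bilinear expression,
so both can be moved to an orthonormal basis, one index at a time. -/
theorem IsSelfDualWeyl.star_eq {b : Fin 4 → Coord 𝕜 4} (hT : IsSelfDualWeyl β vol T)
    (hs : ∀ u v, β u v = β v u) (hb : IsOrthonormalFor β b) (u v w t : Coord 𝕜 4) :
    T u v w t = 1 / 2 * ∑ i, ∑ j, vol ![u, v, b i, b j] * T (b i) (b j) w t := by
  have hm : ∀ {E : Type _} [AddCommGroup E] [Module 𝕜 E] {f : E → 𝕜} (c : 𝕜),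
      IsLinearMap 𝕜 f → IsLinearMap 𝕜 fun z => c * f z := fun c hf =>
    ⟨fun z z' => by rw [hf.map_add, mul_add], fun a z => by
      rw [hf.map_smul, smul_eq_mul, smul_eq_mul, mul_left_comm]⟩
  have hm' : ∀ {E : Type _} [AddCommGroup E] [Module 𝕜 E] {f : E → 𝕜} (c : 𝕜),
      IsLinearMap 𝕜 f → IsLinearMap 𝕜 fun z => f z * c := fun c hf => by
    simpa only [mul_comm _ c] using hm c hf
  have h1 : ∀ i, ∑ j, vol ![u, v, coordVec 𝕜 i, coordVec 𝕜 j]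
      * T (dualVec β i) (dualVec β j) w t =
      ∑ j, vol ![u, v, coordVec 𝕜 i, b j] * T (dualVec β i) (b j) w t := fun i =>
    hb.sum_coordVec_dualVec_of_isLinearMap hs
      (f := fun z z' => vol ![u, v, coordVec 𝕜 i, z] * T (dualVec β i) z' w t)
      (fun _ => hm' _ (isLinearMap_volume_fourth vol u v _))
      (fun _ => hm _ (hT.quad.snd _ w t))
  rw [hT.star u v w t]
  simp_rw [h1]
  rw [Finset.sum_comm, Finset.sum_comm (f := fun i j => vol ![u, v, b i, b j] * T (b i) (b j) w t)]
  refine congrArg _ (Finset.sum_congr rfl fun j _ => ?_)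
  exact hb.sum_coordVec_dualVec_of_isLinearMap hs
      (f := fun z z' => vol ![u, v, z, b j] * T z' (b j) w t)
      (fun _ => hm' _ (isLinearMap_volume_third vol u v _))
      (fun _ => hm _ (hT.quad.fst _ w t))

/-- `L` is the inclusion of a hyperplane with orthonormal basis `e` and unit normal `ν`. -/
structure IsAdaptedBasis (β : Bil 𝕜 (Coord 𝕜 4)) (L : Coord 𝕜 3 →L[𝕜] Coord 𝕜 4)
    (e : Fin 3 → Coord 𝕜 3) (ν : Coord 𝕜 4) : Prop where
  symm : ∀ u v, β u v = β v u
  tangent : ∀ i j, β (L (e i)) (L (e j)) = if i = j then 1 else 0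
  normal : ∀ X, β (L X) ν = 0
  unit : β ν ν = 1

namespace IsAdaptedBasis

theorem isOrthonormalFor (h : IsAdaptedBasis β L e ν) :
    IsOrthonormalFor β (Fin.cons ν fun i => L (e i) : Fin 4 → Coord 𝕜 4) :=
  IsOrthonormalFor.cons h.symm h.tangent (fun i => h.normal (e i)) h.unit

theorem isOrthonormalFor_tangent (h : IsAdaptedBasis β L e ν) :
    IsOrthonormalFor (β.bilinearComp L L) e := h.tangent

theorem sum_repr_tangent (h : IsAdaptedBasis β L e ν) (X : Coord 𝕜 3) :
    X = ∑ i, β (L (e i)) (L X) • e i :=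
  h.isOrthonormalFor_tangent.sum_repr X

theorem sum_repr (h : IsAdaptedBasis β L e ν) (v : Coord 𝕜 4) :
    v = β ν v • ν + ∑ i, β (L (e i)) v • L (e i) := by
  have := h.isOrthonormalFor.sum_repr v
  rwa [Fin.sum_univ_succ] at this

theorem exists_eq_add (h : IsAdaptedBasis β L e ν) (v : Coord 𝕜 4) :
    ∃ (c : 𝕜) (X : Coord 𝕜 3), v = c • ν + L X :=
  ⟨β ν v, ∑ i, β (L (e i)) v • e i, by rw [map_sum]; simpa only [map_smul] using h.sum_repr v⟩

theorem trace_eq_zero (h : IsAdaptedBasis β L e ν) (hT : IsSelfDualWeyl β vol T)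
    (v t : Coord 𝕜 4) : T ν v ν t + ∑ i, T (L (e i)) v (L (e i)) t = 0 := by
  have := hT.trace v t
  rw [h.isOrthonormalFor.sum_coordVec_dualVec_of_isLinearMap h.symm (f := fun u w => T u v w t)
    (fun w => hT.quad.fst v w t) (fun u => hT.quad.trd u v t), Fin.sum_univ_succ] at this
  exact this

/-- The pairs (ν, e_i) and (e_i, ν) contribute equally, as both factors change sign; this absorbs
the factor 1/2 in the first sum. The pair (ν, ν) contributes nothing. -/
theorem star_eq (h : IsAdaptedBasis β L e ν) (hT : IsSelfDualWeyl β vol T)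
    (u v w t : Coord 𝕜 4) : T u v w t =
      ∑ i, vol ![u, v, L (e i), ν] * T (L (e i)) ν w t
      + 1 / 2 * ∑ i, ∑ j, vol ![u, v, L (e i), L (e j)] * T (L (e i)) (L (e j)) w t := by
  rw [hT.star_eq h.symm h.isOrthonormalFor u v w t]
  have h1 : ∀ i, vol ![u, v, ν, L (e i)] * T ν (L (e i)) w t =
      vol ![u, v, L (e i), ν] * T (L (e i)) ν w t := fun i => by
    rw [volume_swap, hT.antisymm ν]
    ring
  simp only [Fin.sum_univ_succ (n := 3), Fin.cons_zero, Fin.cons_succ, volume_self, h1,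
    Finset.sum_add_distrib]
  ring

/-- A self-dual Weyl tensor vanishes if its components with exactly one normal argument do. -/
theorem eq_zero_of_normal_eq_zero (h : IsAdaptedBasis β L e ν) (hT : IsSelfDualWeyl β vol T)
    (h0 : ∀ X Y Z, T (L X) (L Y) (L Z) ν = 0) (u v w t : Coord 𝕜 4) : T u v w t = 0 := by
  have skew : ∀ u v w t, T u v w t = - T u v t w := fun u v w t => by
    rw [hT.pair_symm, hT.antisymm, hT.pair_symm t w]
  have hself : ∀ u w t, T u u w t = 0 := fun u w t => self_eq_neg.1 (hT.antisymm u u w t)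
  have hself' : ∀ u v w, T u v w w = 0 := fun u v w => by rw [hT.pair_symm, hself]
  have a1 : ∀ X Y Z, T (L X) (L Y) ν (L Z) = 0 := fun X Y Z => by rw [skew, h0, neg_zero]
  have a2 : ∀ X Y Z, T (L X) ν (L Y) (L Z) = 0 := fun X Y Z => by rw [hT.pair_symm, h0]
  have a3 : ∀ X Y Z, T ν (L X) (L Y) (L Z) = 0 := fun X Y Z => by rw [hT.pair_symm, a1]
  -- The dual of ν ∧ X is tangential, so this component reduces to those with one normal argument.
  have b1 : ∀ X Z, T ν (L X) (L Z) ν = 0 := fun X Z => by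
    rw [h.star_eq hT]
    have : ∀ i, vol ![ν, L X, L (e i), ν] = 0 := fun i =>
      vol.map_eq_zero_of_eq _ (i := 0) (j := 3) rfl (by decide)
    simp [this, h0]
  have b2 : ∀ X Z, T ν (L X) ν (L Z) = 0 := fun X Z => by rw [skew, b1, neg_zero]
  have b3 : ∀ X Z, T (L X) ν (L Z) ν = 0 := fun X Z => by rw [hT.antisymm, b1, neg_zero]
  have b4 : ∀ X Z, T (L X) ν ν (L Z) = 0 := fun X Z => by rw [skew, b3, neg_zero]
  -- The dual of a tangential bivector is a combination of the e_i ∧ ν, since `vol` vanishes on four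
  -- tangent vectors.
  have c1 : ∀ X Y Z V, T (L X) (L Y) (L Z) (L V) = 0 := fun X Y Z V => by
    rw [h.star_eq hT]
    simp [a2, volume_eq_zero_of_range]
  obtain ⟨T', hT'⟩ := hT.quad.exists_linearMap
  obtain ⟨cu, X, rfl⟩ := h.exists_eq_add u
  obtain ⟨cv, Y, rfl⟩ := h.exists_eq_add v
  obtain ⟨cw, Z, rfl⟩ := h.exists_eq_add w
  obtain ⟨ct, V, rfl⟩ := h.exists_eq_add t
  rw [← hT']
  simp only [map_add, map_smul, LinearMap.add_apply, LinearMap.smul_apply, hT', hself, hself', h0,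
    a1, a2, a3, b1, b2, b3, b4, c1, smul_zero, add_zero]

/-- Pair symmetry brings Z ∧ V to the front, where self-duality replaces it by the sum of vol(Z, V,
e_i, ν) e_i ∧ ν. These coefficients are the components of `S` in the basis `e`. -/
theorem apply_eq_of_hodgeStar (h : IsAdaptedBasis β L e ν) (hT : IsSelfDualWeyl β vol T)
    (X Y : Coord 𝕜 3) {Z V S : Coord 𝕜 3} (hS : ∀ U, β (L S) (L U) = vol ![L Z, L V, L U, ν]) :
    T (L X) (L Y) (L Z) (L V) = T (L X) (L Y) (L S) ν := by
  obtain ⟨T', hT'⟩ := hT.quad.exists_linearMap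
  rw [hT.pair_symm, h.star_eq hT, hT.pair_symm (L X) (L Y) (L S) ν]
  conv_rhs => rw [h.sum_repr_tangent S]
  rw [← hT']
  simp [← hS, volume_eq_zero_of_range, hT', h.symm (L S)]

/-- The trace-free part of the equation `T(X, Y, Z, ν) = -C(X, Y, Z) + ⟨X, Z⟩ a(Y) - ⟨Y, Z⟩ a(X)`
for a tensor `C` without trace. -/
theorem eq_zero_of_codazzi (h : IsAdaptedBasis β L e ν) (hT : IsSelfDualWeyl β vol T)
    {C : Coord 𝕜 3 → Coord 𝕜 3 → Coord 𝕜 3 → 𝕜} {a : Coord 𝕜 3 → 𝕜}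
    (hC : ∀ Y, ∑ i, C (e i) Y (e i) = 0)
    (ha : ∀ X Y Z, T (L X) (L Y) (L Z) ν =
      - C X Y Z + β (L X) (L Z) * a Y - β (L Y) (L Z) * a X) (Y : Coord 𝕜 3) : a Y = 0 := by
  -- Contraction over X = Z = e_i; the left side has no trace because T(ν, Y, ν, ν) = 0. As `a` is
  -- not assumed linear, the relation is solved first at the e_j, where it reads 2 a(e_j) = 0, and
  -- then at an arbitrary `Y`.
  have key : ∀ Y, 3 * a Y - ∑ i, β (L Y) (L (e i)) * a (e i) = 0 := fun Y => by
    have h1 := h.trace_eq_zero hT (L Y) ν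
    have h2 : T ν (L Y) ν ν = 0 := self_eq_neg.1 <| by
      conv_lhs => rw [hT.pair_symm, hT.antisymm, hT.pair_symm]
    rw [h2, zero_add] at h1
    simp only [ha, Finset.sum_sub_distrib, Finset.sum_add_distrib, Finset.sum_neg_distrib, hC,
      h.tangent, if_true, Finset.sum_const, Finset.card_univ, Fintype.card_fin, one_mul,
      nsmul_eq_mul] at h1
    rw [← h1]
    push_cast
    ring
  have hej : ∀ j, a (e j) = 0 := fun j => by
    have := key (e j)
    simp only [h.tangent, ite_mul, one_mul, zero_mul, Finset.sum_ite_eq, Finset.mem_univ,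
      if_true] at this
    linear_combination (1 / 2) * this
  have := key Y
  simp only [hej, mul_zero, Finset.sum_const_zero, sub_zero] at this
  linear_combination (1 / 3) * this

/-- A tensor that satisfies the contracted Bianchi identity is trace-free. -/
theorem trace_eq_zero_of_bianchi (h : IsAdaptedBasis β L e ν)
    {C : Coord 𝕜 3 → Coord 𝕜 3 → Coord 𝕜 3 → 𝕜} (hanti : ∀ X Y Z, C X Y Z = - C Y X Z)
    (hlin : ∀ X Z, IsLinearMap 𝕜 fun Y => C X Y Z)
    (hB : ∀ m u v w t, C m u w * β (L v) (L t) - C m u t * β (L v) (L w)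
      + C u v w * β (L m) (L t) - C u v t * β (L m) (L w)
      + C v m w * β (L u) (L t) - C v m t * β (L u) (L w) = 0) (Y : Coord 𝕜 3) :
    ∑ i, C (e i) Y (e i) = 0 := by
  have hself : ∀ X Z, C X X Z = 0 := fun X Z => self_eq_neg.1 (hanti X X Z)
  have key : ∀ j, ∑ i, C (e i) (e j) (e i) = 0 := fun j => by
    -- Indices are modulo 3, so the three form arguments are distinct. With this choice only the two
    -- terms of the trace at `e j` survive.
    have h1 := hB (e j) (e (j + 1)) (e (j + 2)) (e (j + 1)) (e (j + 2))
    simp only [h.tangent] at h1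
    fin_cases j
    · simp [Fin.sum_univ_three, hself] at h1 ⊢
      rw [hanti (e 1) (e 0)]
      linear_combination -h1
    · simp [Fin.sum_univ_three, hself] at h1 ⊢
      rw [hanti (e 2) (e 1)]
      linear_combination -h1
    · simp [Fin.sum_univ_three, hself] at h1 ⊢
      rw [hanti (e 0) (e 2)]
      linear_combination -h1
  have hl : IsLinearMap 𝕜 fun Y => ∑ i, C (e i) Y (e i) := isLinearMap_sum fun i _ => hlin _ _
  have := congrArg (hl.mk' _) (h.sum_repr_tangent Y)
  rw [map_sum] at this
  simpa [key] using this

end IsAdaptedBasis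

end AdaptedBasis

/-! ### Gauss and Codazzi equations. -/

section Gauss

variable {𝕜 : Type*} [RCLike 𝕜] {E E' : Type*} [NormedAddCommGroup E] [NormedSpace 𝕜 E]
  [NormedAddCommGroup E'] [NormedSpace 𝕜 E']

/-- The combined Gauss and Codazzi equations of a map `F` whose second fundamental form is
`γ ⊗ h`. -/
theorem connCurv_map_eq {F : E → E'} {Γ : E → E →L[𝕜] E →L[𝕜] E}
    {Γ' : E' → E' →L[𝕜] E' →L[𝕜] E'} {γ : E → Bil 𝕜 E} {h : E → E'} {y : E}
    (hF : ContDiffAt 𝕜 ∞ F y) (hΓ : DifferentiableAt 𝕜 Γ y) (hΓ' : DifferentiableAt 𝕜 Γ' (F y))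
    (hγ : DifferentiableAt 𝕜 γ y) (hh : DifferentiableAt 𝕜 h y)
    (hm : ∀ m u v, fderiv 𝕜 γ y m u v = γ y (Γ y m u) v + γ y u (Γ y m v))
    (hs : ∀ u v, Γ y u v = Γ y v u) (hγs : ∀ u v, γ y u v = γ y v u)
    (heq : ∀ᶠ z in 𝓝 y, ∀ X Y, fderiv 𝕜 (fderiv 𝕜 F) z X Y
      + Γ' (F z) (fderiv 𝕜 F z X) (fderiv 𝕜 F z Y) = fderiv 𝕜 F z (Γ z X Y) + γ z X Y • h z)
    (X Y Z : E) :
    connCurv Γ' (F y) (fderiv 𝕜 F y X) (fderiv 𝕜 F y Y) (fderiv 𝕜 F y Z) =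
      fderiv 𝕜 F y (connCurv Γ y X Y Z)
      - γ y Y Z • (fderiv 𝕜 h y X + Γ' (F y) (fderiv 𝕜 F y X) (h y))
      + γ y X Z • (fderiv 𝕜 h y Y + Γ' (F y) (fderiv 𝕜 F y Y) (h y)) := by
  have hFd := hF.differentiableAt_infty
  have hdF := hF.fderiv_infty.differentiableAt_infty
  have hf : ContDiffAt 𝕜 ∞ (fun z => fderiv 𝕜 F z Z) y :=
    hF.fderiv_infty.clm_apply contDiffAt_const
  have hev : ∀ᶠ z in 𝓝 y, DifferentiableAt 𝕜 (fderiv 𝕜 F) z :=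
    ((hF.fderiv_infty.of_le (m := 1) (by simp)).eventually (by simp)).mono
      fun z hz => hz.differentiableAt (by simp)
  have dconst : ∀ X : E, DifferentiableAt 𝕜 (fun z => fderiv 𝕜 F z X) y := fun X =>
    hdF.clm_apply (differentiableAt_const X)
  have dΓ : ∀ X, DifferentiableAt 𝕜 (fun z => Γ z X Z) y := fun X =>
    (hΓ.clm_apply (differentiableAt_const X)).clm_apply (differentiableAt_const Z)
  have dγ : ∀ X, DifferentiableAt 𝕜 (fun z => γ z X Z) y := fun X =>
    (hγ.clm_apply (differentiableAt_const X)).clm_apply (differentiableAt_const Z)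
  have dΓ' : DifferentiableAt 𝕜 (fun z => Γ' (F z)) y := DifferentiableAt.comp (g := Γ') y hΓ' hFd
  have hΓ'F : ∀ X, fderiv 𝕜 (fun z => Γ' (F z)) y X = fderiv 𝕜 Γ' (F y) (fderiv 𝕜 F y X) :=
    fun X => by
      have := fderiv_comp (g := Γ') y hΓ' hFd
      rw [show (fun z => Γ' (F z)) = Γ' ∘ F from rfl, this]
      rfl
  have hdd : ∀ X Y, fderiv 𝕜 (fderiv 𝕜 F) y X Y = fderiv 𝕜 F y (Γ y X Y) + γ y X Y • h y
      - Γ' (F y) (fderiv 𝕜 F y X) (fderiv 𝕜 F y Y) := fun X Y => by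
    rw [← heq.self_of_nhds X Y]
    abel
  -- The third derivative of `F`, computed by differentiating the Gauss formula `heq`.
  have key : ∀ X Y, fderiv 𝕜 (fderiv 𝕜 fun z => fderiv 𝕜 F z Z) y X Y =
      (fderiv 𝕜 (fderiv 𝕜 F) y X (Γ y Y Z) + fderiv 𝕜 F y (fderiv 𝕜 Γ y X Y Z))
      + ((γ y (Γ y X Y) Z + γ y Y (Γ y X Z)) • h y + γ y Y Z • fderiv 𝕜 h y X)
      - (fderiv 𝕜 Γ' (F y) (fderiv 𝕜 F y X) (fderiv 𝕜 F y Y) (fderiv 𝕜 F y Z)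
        + Γ' (F y) (fderiv 𝕜 (fderiv 𝕜 F) y X Y) (fderiv 𝕜 F y Z)
        + Γ' (F y) (fderiv 𝕜 F y Y) (fderiv 𝕜 (fderiv 𝕜 F) y X Z)) := by
    intro X Y
    have h1 : ∀ᶠ z in 𝓝 y, fderiv 𝕜 (fun z => fderiv 𝕜 F z Z) z Y =
        fderiv 𝕜 F z (Γ z Y Z) + γ z Y Z • h z
          - Γ' (F z) (fderiv 𝕜 F z Y) (fderiv 𝕜 F z Z) := by
      filter_upwards [heq, hev] with z hz hz'
      rw [fderiv_clm_apply_const hz', ← hz]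
      abel
    rw [← fderiv_clm_apply_const hf.fderiv_infty.differentiableAt_infty,
      fderiv_apply_eq_of_eventuallyEq h1,
      fderiv_sub_apply' ((hdF.clm_apply (dΓ Y)).fun_add ((dγ Y).fun_smul hh))
        ((dΓ'.clm_apply (dconst Y)).clm_apply (dconst Z)),
      fderiv_add_apply' (hdF.clm_apply (dΓ Y)) ((dγ Y).fun_smul hh),
      fderiv_clm_apply_apply hdF (dΓ Y), fderiv_smul_apply' (dγ Y) hh,
      fderiv_clm_apply_apply₂ dΓ' (dconst Y) (dconst Z), fderiv_clm_apply_const₂ hΓ,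
      fderiv_clm_apply_const₂ hγ, hm, fderiv_clm_apply_const hdF, fderiv_clm_apply_const hdF, hΓ'F]
  -- Symmetry of the third derivative in `X` and `Y` is the integrability condition. After second
  -- derivatives of `F` are eliminated with the Gauss formula, it compares the two curvatures.
  have hsymm := hf.fderiv_fderiv_comm X Y
  rw [key, key, hF.fderiv_fderiv_comm Y X] at hsymm
  rw [hdd X (Γ y Y Z), hdd Y (Γ y X Z), hdd X Z, hdd Y Z, hs Y X,
    hγs X (Γ y Y Z), hγs Y (Γ y X Z), hγs (Γ y Y Z) X, hγs (Γ y X Z) Y] at hsymm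
  simp only [connCurv, map_neg, map_add, map_sub, map_smul] at hsymm ⊢
  rw [← sub_eq_zero] at hsymm ⊢
  rw [← hsymm]
  module

end Gauss

/-! ### Umbilic hypersurfaces in coordinates. -/

section Hypersurface

variable {𝕜 : Type*} [RCLike 𝕜] {n m : ℕ}

/-- The pull-back of a field of bilinear forms by a map between coordinate spaces. -/
noncomputable def pullbackBil (g : Coord 𝕜 n → Bil 𝕜 (Coord 𝕜 n)) (F : Coord 𝕜 m → Coord 𝕜 n)
    (y : Coord 𝕜 m) : Bil 𝕜 (Coord 𝕜 m) :=
  (g (F y)).bilinearComp (fderiv 𝕜 F y) (fderiv 𝕜 F y)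

@[simp]
theorem pullbackBil_apply (g : Coord 𝕜 n → Bil 𝕜 (Coord 𝕜 n)) (F : Coord 𝕜 m → Coord 𝕜 n)
    (y X Y : Coord 𝕜 m) :
    pullbackBil g F y X Y = g (F y) (fderiv 𝕜 F y X) (fderiv 𝕜 F y Y) := rfl

theorem contDiffAt_pullbackBil {g : Coord 𝕜 n → Bil 𝕜 (Coord 𝕜 n)} {F : Coord 𝕜 m → Coord 𝕜 n}
    {y : Coord 𝕜 m} (hg : ContDiffAt 𝕜 ∞ g (F y)) (hF : ContDiffAt 𝕜 ∞ F y) :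
    ContDiffAt 𝕜 ∞ (pullbackBil g F) y := by
  have h : pullbackBil g F = fun z => bilOfCoord fun u v => pullbackBil g F z u v := by
    funext z
    ext u v
    exact (bilOfCoord_apply (isLinearMap_clm_left _) (fun u => isLinearMap_clm _) u v).symm
  rw [h]
  have hgF : ContDiffAt 𝕜 ∞ (fun z => g (F z)) y := ContDiffAt.comp (g := g) y hg hF
  exact contDiffAt_bilOfCoord fun i j => (hgF.clm_apply
    (hF.fderiv_infty.clm_apply contDiffAt_const)).clm_apply
      (hF.fderiv_infty.clm_apply contDiffAt_const)

/-- Near `p`, `F` parametrizes a nondegenerate umbilic hypersurface for the metric `g`. -/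
structure IsUmbilicHypersurfaceNear (g : Coord 𝕜 4 → Bil 𝕜 (Coord 𝕜 4))
    (F : Coord 𝕜 3 → Coord 𝕜 4) (p : Coord 𝕜 3) : Prop where
  metric : IsMetricNear g (F p)
  smooth : ∀ᶠ y in 𝓝 p, ContDiffAt 𝕜 ∞ F y
  nondegenerate : ∀ᶠ y in 𝓝 p, ∀ X, (∀ Y, pullbackBil g F y X Y = 0) → X = 0
  umbilic : ∀ᶠ y in 𝓝 p, ∀ ν, (∀ Z, g (F y) (fderiv 𝕜 F y Z) ν = 0) →
    ∃ H : 𝕜, ∀ X Y, secondFundamentalForm g F y ν X Y = H * pullbackBil g F y X Y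

/-- Near `p`, `h` is the mean curvature vector field of an umbilic hypersurface: the second
fundamental form is the induced metric times `h`. -/
def IsMeanCurvatureNear (g : Coord 𝕜 4 → Bil 𝕜 (Coord 𝕜 4))
    (F h : Coord 𝕜 3 → Coord 𝕜 4) (p : Coord 𝕜 3) : Prop :=
  ∀ᶠ y in 𝓝 p, ContDiffAt 𝕜 ∞ h y ∧
    (∀ X, g (F y) (fderiv 𝕜 F y X) (h y) = 0) ∧ ∀ X Y, fderiv 𝕜 (fderiv 𝕜 F) y X Y
    + christoffelBil g (F y) (fderiv 𝕜 F y X) (fderiv 𝕜 F y Y) =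
      fderiv 𝕜 F y (christoffelBil (pullbackBil g F) y X Y) + pullbackBil g F y X Y • h y

variable {g : Coord 𝕜 4 → Bil 𝕜 (Coord 𝕜 4)} {F : Coord 𝕜 3 → Coord 𝕜 4} {p : Coord 𝕜 3}

namespace IsUmbilicHypersurfaceNear

theorem contDiffAt (hQ : IsUmbilicHypersurfaceNear g F p) : ContDiffAt 𝕜 ∞ F p :=
  hQ.smooth.self_of_nhds

theorem eventually (hQ : IsUmbilicHypersurfaceNear g F p) :
    ∀ᶠ y in 𝓝 p, IsUmbilicHypersurfaceNear g F y := by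
  filter_upwards [hQ.contDiffAt.continuousAt.eventually hQ.metric.eventually,
    hQ.smooth.eventually_nhds, hQ.nondegenerate.eventually_nhds, hQ.umbilic.eventually_nhds]
    with y h1 h2 h3 h4 using ⟨h1, h2, h3, h4⟩

/-- The values of the induced form on the diagonal are values of `g`, hence squares; together with
nondegeneracy this gives an orthonormal basis over either field. -/
theorem exists_tangent_basis (hQ : IsUmbilicHypersurfaceNear g F p) :
    ∃ e : Fin 3 → Coord 𝕜 3, IsOrthonormalFor (pullbackBil g F p) e := by
  obtain ⟨b, hb⟩ := hQ.metric.exists_orthonormal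
  exact exists_isOrthonormalFor (fun u v => hQ.metric.symm _ _) hQ.nondegenerate.self_of_nhds
    fun v => hb.exists_sq_eq hQ.metric.symm _

theorem isMetricNear_pullbackBil (hQ : IsUmbilicHypersurfaceNear g F p) :
    IsMetricNear (pullbackBil g F) p := by
  filter_upwards [hQ.eventually] with y hy
  exact ⟨contDiffAt_pullbackBil hy.metric.contDiffAt hy.contDiffAt,
    fun u v => hy.metric.symm _ _, hy.exists_tangent_basis⟩

theorem exists_isAdaptedBasis_of_normal (hQ : IsUmbilicHypersurfaceNear g F p) {ν : Coord 𝕜 4}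
    (hν : ∀ X, g (F p) (fderiv 𝕜 F p X) ν = 0) (h1 : g (F p) ν ν = 1) :
    ∃ e, IsAdaptedBasis (g (F p)) (fderiv 𝕜 F p) e ν := by
  obtain ⟨e, he⟩ := hQ.exists_tangent_basis
  exact ⟨e, hQ.metric.symm, he, hν, h1⟩

theorem exists_isAdaptedBasis (hQ : IsUmbilicHypersurfaceNear g F p) :
    ∃ e ν, IsAdaptedBasis (g (F p)) (fderiv 𝕜 F p) e ν := by
  obtain ⟨e, he⟩ := hQ.exists_tangent_basis
  obtain ⟨b, hb⟩ := hQ.metric.exists_orthonormal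
  obtain ⟨ν, hν, h1⟩ := hb.exists_normal hQ.metric.symm (e := fun i => fderiv 𝕜 F p (e i)) he
  refine ⟨e, ν, hQ.metric.symm, he, fun X => ?_, h1⟩
  rw [he.sum_repr X]
  simp [map_sum, hν]

theorem fderiv_pullbackBil (hQ : IsUmbilicHypersurfaceNear g F p) (X Y Z : Coord 𝕜 3) :
    fderiv 𝕜 (pullbackBil g F) p X Y Z =
      g (F p) (fderiv 𝕜 (fderiv 𝕜 F) p X Y
        + christoffelBil g (F p) (fderiv 𝕜 F p X) (fderiv 𝕜 F p Y)) (fderiv 𝕜 F p Z)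
      + g (F p) (fderiv 𝕜 (fderiv 𝕜 F) p X Z
        + christoffelBil g (F p) (fderiv 𝕜 F p X) (fderiv 𝕜 F p Z)) (fderiv 𝕜 F p Y) := by
  have hF := hQ.contDiffAt.differentiableAt_infty
  have hdF := hQ.contDiffAt.fderiv_infty.differentiableAt_infty
  have hg := hQ.metric.contDiffAt.differentiableAt_infty
  have hgF : DifferentiableAt 𝕜 (fun y => g (F y)) p := DifferentiableAt.comp (g := g) p hg hF
  have hgF' : fderiv 𝕜 (fun y => g (F y)) p X = fderiv 𝕜 g (F p) (fderiv 𝕜 F p X) := by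
    rw [show (fun y => g (F y)) = g ∘ F from rfl, fderiv_comp (g := g) p hg hF]
    rfl
  rw [← fderiv_clm_apply_const₂ hQ.isMetricNear_pullbackBil.contDiffAt.differentiableAt_infty]
  simp only [pullbackBil_apply]
  rw [fderiv_clm_apply_apply₂ hgF (hdF.clm_apply (differentiableAt_const Y))
    (hdF.clm_apply (differentiableAt_const Z)), fderiv_clm_apply_const hdF,
    fderiv_clm_apply_const hdF, hgF', hQ.metric.fderiv_apply,
    hQ.metric.symm (fderiv 𝕜 F p Y), hQ.metric.symm (fderiv 𝕜 F p Y)]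
  simp only [map_add, add_apply]
  ring

/-- The tangential part of the Gauss formula. -/
theorem apply_christoffelBil_pullbackBil (hQ : IsUmbilicHypersurfaceNear g F p)
    (X Y Z : Coord 𝕜 3) :
    g (F p) (fderiv 𝕜 F p (christoffelBil (pullbackBil g F) p X Y)) (fderiv 𝕜 F p Z) =
      g (F p) (fderiv 𝕜 (fderiv 𝕜 F) p X Y
        + christoffelBil g (F p) (fderiv 𝕜 F p X) (fderiv 𝕜 F p Y)) (fderiv 𝕜 F p Z) := by
  have h := hQ.isMetricNear_pullbackBil.apply_christoffel X Y Z
  rw [← christoffelBil_apply, pullbackBil_apply] at h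
  rw [h, hQ.fderiv_pullbackBil, hQ.fderiv_pullbackBil, hQ.fderiv_pullbackBil,
    hQ.contDiffAt.fderiv_fderiv_comm Y X, hQ.contDiffAt.fderiv_fderiv_comm Z X,
    hQ.contDiffAt.fderiv_fderiv_comm Z Y, hQ.metric.christoffelBil_comm (fderiv 𝕜 F p Y)
      (fderiv 𝕜 F p X), hQ.metric.christoffelBil_comm (fderiv 𝕜 F p Z) (fderiv 𝕜 F p X),
    hQ.metric.christoffelBil_comm (fderiv 𝕜 F p Z) (fderiv 𝕜 F p Y)]
  ring

/-- The Gauss formula at a point of an umbilic hypersurface. -/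
theorem exists_meanCurvature_at (hQ : IsUmbilicHypersurfaceNear g F p) :
    ∃ h : Coord 𝕜 4, (∀ X, g (F p) (fderiv 𝕜 F p X) h = 0) ∧ ∀ X Y, fderiv 𝕜 (fderiv 𝕜 F) p X Y
      + christoffelBil g (F p) (fderiv 𝕜 F p X) (fderiv 𝕜 F p Y) =
        fderiv 𝕜 F p (christoffelBil (pullbackBil g F) p X Y) + pullbackBil g F p X Y • h := by
  obtain ⟨e, ν, hb⟩ := hQ.exists_isAdaptedBasis
  obtain ⟨H, hH⟩ := hQ.umbilic.self_of_nhds ν hb.normal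
  -- The factor `H` comes from umbilicity in the direction of the unit normal. The vector equation
  -- is then tested on ν and on tangent vectors, where it reduces to `hH` and to the tangential
  -- Gauss formula.
  refine ⟨H • ν, fun X => by simp [hb.normal], fun X Y => ?_⟩
  refine eq_of_forall_apply_eq hQ.metric.isInvertible fun t => ?_
  obtain ⟨c, Z, rfl⟩ := hb.exists_eq_add t
  have h1 := hQ.apply_christoffelBil_pullbackBil X Y Z
  have h2 := hH X Y
  rw [secondFundamentalForm, ← christoffelBil_apply, fderiv_clm_apply_const
    hQ.contDiffAt.fderiv_infty.differentiableAt_infty] at h2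
  have h3 : g (F p) ν (fderiv 𝕜 F p Z) = 0 := by rw [hb.symm, hb.normal]
  simp only [map_add, add_apply, map_smul, smul_apply, smul_eq_mul, hb.normal, hb.unit, h3]
    at h1 h2 ⊢
  linear_combination c * h2 - h1

/-- The vector found at each point carries no smoothness. Solving the Gauss formula for it at X = Y
= e_0, a constant vector with γ(e_0, e_0) ≠ 0 near `p`, gives a smooth expression with the same
values. -/
theorem exists_meanCurvature (hQ : IsUmbilicHypersurfaceNear g F p) :
    ∃ h : Coord 𝕜 3 → Coord 𝕜 4, IsMeanCurvatureNear g F h p := by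
  obtain ⟨e, he⟩ := hQ.exists_tangent_basis
  have hne : ∀ᶠ y in 𝓝 p, pullbackBil g F y (e 0) (e 0) ≠ 0 := by
    refine (hQ.isMetricNear_pullbackBil.contDiffAt_apply (e 0) (e 0)).continuousAt.eventually_ne ?_
    rw [he]
    simp
  refine ⟨fun y => (pullbackBil g F y (e 0) (e 0))⁻¹ • (fderiv 𝕜 (fderiv 𝕜 F) y (e 0) (e 0)
      + christoffelBil g (F y) (fderiv 𝕜 F y (e 0)) (fderiv 𝕜 F y (e 0))
      - fderiv 𝕜 F y (christoffelBil (pullbackBil g F) y (e 0) (e 0))), ?_⟩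
  filter_upwards [hne, hQ.eventually] with y hy hQy
  obtain ⟨h, h1, h2⟩ := hQy.exists_meanCurvature_at
  have hval : (pullbackBil g F y (e 0) (e 0))⁻¹ • (fderiv 𝕜 (fderiv 𝕜 F) y (e 0) (e 0)
      + christoffelBil g (F y) (fderiv 𝕜 F y (e 0)) (fderiv 𝕜 F y (e 0))
      - fderiv 𝕜 F y (christoffelBil (pullbackBil g F) y (e 0) (e 0))) = h := by
    rw [h2, add_sub_cancel_left, smul_smul, inv_mul_cancel₀ hy, one_smul]
  have hc : ContDiffAt 𝕜 ∞ (fun _ : Coord 𝕜 3 => e 0) y := contDiffAt_const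
  have hdF := hQy.contDiffAt.fderiv_infty
  have hγ := hQy.isMetricNear_pullbackBil
  have hΓ : ContDiffAt 𝕜 ∞ (fun z => christoffelBil g (F z)) y :=
    ContDiffAt.comp (g := christoffelBil g) y hQy.metric.contDiffAt_christoffelBil hQy.contDiffAt
  refine ⟨((hγ.contDiffAt_apply (e 0) (e 0)).inv hy).smul
    ((((hdF.fderiv_infty.clm_apply hc).clm_apply hc).add
      ((hΓ.clm_apply (hdF.clm_apply hc)).clm_apply (hdF.clm_apply hc))).sub
      (hdF.clm_apply ((hγ.contDiffAt_christoffelBil.clm_apply hc).clm_apply hc))), ?_⟩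
  rw [hval]
  exact ⟨h1, h2⟩

end IsUmbilicHypersurfaceNear

end Hypersurface

/-! ### The theorem in coordinates. -/

section UmbilicTheorem

variable {𝕜 : Type*} [RCLike 𝕜]

/-- In dimension three the curvature determines the normalized Ricci tensor `k` by
`R = k ∧ I`. -/
theorem IsMetricNear.normRicciBil_eq_of_riemann_eq {γ : Coord 𝕜 3 → Bil 𝕜 (Coord 𝕜 3)}
    {p : Coord 𝕜 3} (hγ : IsMetricNear γ p) {k : Bil 𝕜 (Coord 𝕜 3)}
    (hk : ∀ X Y Z T, γ p (riemann γ p X Y Z) T = k X Z * γ p Y T - γ p Y Z * k X T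
      - (k Y Z * γ p X T - γ p X Z * k Y T)) (X Y : Coord 𝕜 3) :
    normRicciBil γ p X Y = k X Y := by
  obtain ⟨e, he⟩ := hγ.exists_orthonormal
  -- In dimension three the normalized Ricci tensor is Ric - (Scal/4) γ. Contracting k ∧ I gives Ric
  -- = k + (tr k) γ and Scal = 4 tr k, so the trace terms cancel.
  have hr : ∀ X Y, ricci γ p X Y = k X Y + γ p X Y * ∑ a, k (e a) (e a) := fun X Y => by
    have h2 : ∑ a, γ p (e a) Y * k X (e a) = k X Y := by
      conv_rhs => rw [he.sum_repr Y]
      simp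
    have h3 : ∑ a, k (e a) Y * γ p X (e a) = k X Y := by
      conv_rhs => rw [he.sum_repr X]
      simp [hγ.symm X, mul_comm]
    rw [hγ.ricci_eq he]
    simp only [hk, Finset.sum_sub_distrib, h2, h3, he _ _, if_true, mul_one, Finset.sum_const,
      Finset.card_univ, Fintype.card_fin, nsmul_eq_mul, ← Finset.mul_sum]
    push_cast
    ring
  have hs : scal γ p = 4 * ∑ a, k (e a) (e a) := by
    rw [hγ.scal_eq he]
    simp only [hr, he _ _, if_true, Finset.sum_add_distrib, one_mul, Finset.sum_const,
      Finset.card_univ, Fintype.card_fin, nsmul_eq_mul]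
    push_cast
    ring
  rw [hγ.normRicciBil_apply, normRicci, hs, hr]
  push_cast
  ring

variable {g : Coord 𝕜 4 → Bil 𝕜 (Coord 𝕜 4)} {F h : Coord 𝕜 3 → Coord 𝕜 4} {p : Coord 𝕜 3}
  {vol : Coord 𝕜 4 → Coord 𝕜 4 [⋀^Fin 4]→L[𝕜] 𝕜}

namespace IsMeanCurvatureNear

theorem eventually (hh : IsMeanCurvatureNear g F h p) :
    ∀ᶠ y in 𝓝 p, IsMeanCurvatureNear g F h y :=
  Filter.Eventually.eventually_nhds hh

theorem differentiableAt (hh : IsMeanCurvatureNear g F h p) : DifferentiableAt 𝕜 h p :=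
  hh.self_of_nhds.1.differentiableAt_infty

theorem normal (hh : IsMeanCurvatureNear g F h p) (X : Coord 𝕜 3) :
    g (F p) (fderiv 𝕜 F p X) (h p) = 0 :=
  hh.self_of_nhds.2.1 X

theorem gauss_formula (hh : IsMeanCurvatureNear g F h p) (X Y : Coord 𝕜 3) :
    fderiv 𝕜 (fderiv 𝕜 F) p X Y =
      fderiv 𝕜 F p (christoffelBil (pullbackBil g F) p X Y) + pullbackBil g F p X Y • h p
      - christoffelBil g (F p) (fderiv 𝕜 F p X) (fderiv 𝕜 F p Y) := by
  rw [← hh.self_of_nhds.2.2 X Y]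
  abel

end IsMeanCurvatureNear

/-- The covariant derivative of a vector field `h` along `F`. -/
noncomputable def covDerivAlong (g : Coord 𝕜 4 → Bil 𝕜 (Coord 𝕜 4)) (F h : Coord 𝕜 3 → Coord 𝕜 4)
    (p X : Coord 𝕜 3) : Coord 𝕜 4 :=
  fderiv 𝕜 h p X + christoffelBil g (F p) (fderiv 𝕜 F p X) (h p)

namespace IsUmbilicHypersurfaceNear

theorem riemann_tangent (hQ : IsUmbilicHypersurfaceNear g F p) (hh : IsMeanCurvatureNear g F h p)
    (X Y Z : Coord 𝕜 3) :
    riemann g (F p) (fderiv 𝕜 F p X) (fderiv 𝕜 F p Y) (fderiv 𝕜 F p Z) =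
      fderiv 𝕜 F p (riemann (pullbackBil g F) p X Y Z)
      - pullbackBil g F p Y Z • covDerivAlong g F h p X
      + pullbackBil g F p X Z • covDerivAlong g F h p Y := by
  have hγ := hQ.isMetricNear_pullbackBil
  rw [hQ.metric.riemann_eq, hγ.riemann_eq]
  exact connCurv_map_eq hQ.contDiffAt hγ.contDiffAt_christoffelBil.differentiableAt_infty
    hQ.metric.contDiffAt_christoffelBil.differentiableAt_infty
    hγ.contDiffAt.differentiableAt_infty hh.differentiableAt hγ.fderiv_apply
    hγ.christoffelBil_comm hγ.symm (hh.mono fun y hy => hy.2.2) X Y Z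

theorem fderiv_apply_along (hQ : IsUmbilicHypersurfaceNear g F p) {v w : Coord 𝕜 3 → Coord 𝕜 4}
    (hv : DifferentiableAt 𝕜 v p) (hw : DifferentiableAt 𝕜 w p) (X : Coord 𝕜 3) :
    fderiv 𝕜 (fun y => g (F y) (v y) (w y)) p X =
      g (F p) (covDerivAlong g F v p X) (w p) + g (F p) (v p) (covDerivAlong g F w p X) := by
  have hF := hQ.contDiffAt.differentiableAt_infty
  have hg := hQ.metric.contDiffAt.differentiableAt_infty
  have hgF : DifferentiableAt 𝕜 (fun y => g (F y)) p := DifferentiableAt.comp (g := g) p hg hF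
  have hgF' : fderiv 𝕜 (fun y => g (F y)) p X = fderiv 𝕜 g (F p) (fderiv 𝕜 F p X) := by
    rw [show (fun y => g (F y)) = g ∘ F from rfl, fderiv_comp (g := g) p hg hF]
    rfl
  rw [fderiv_clm_apply_apply₂ hgF hv hw, hgF', hQ.metric.fderiv_apply, covDerivAlong, covDerivAlong]
  simp only [map_add, add_apply]
  ring

/-- Weingarten equation: differentiate g(h, F_*Z) = 0 and use that the normal part of the derivative
of F_*Z is γ(X,Z) h. -/
theorem covDerivAlong_tangent (hQ : IsUmbilicHypersurfaceNear g F p)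
    (hh : IsMeanCurvatureNear g F h p) (X Z : Coord 𝕜 3) :
    g (F p) (covDerivAlong g F h p X) (fderiv 𝕜 F p Z) =
      - (g (F p) (h p) (h p) * pullbackBil g F p X Z) := by
  have hdF := hQ.contDiffAt.fderiv_infty.differentiableAt_infty
  have h0 : ∀ᶠ y in 𝓝 p, g (F y) (h y) (fderiv 𝕜 F y Z) = 0 := by
    filter_upwards [hh.eventually, hQ.eventually] with y hy hQy
    rw [hQy.metric.symm, hy.normal]
  have h1 := fderiv_apply_eq_of_eventuallyEq (𝕜 := 𝕜) h0 X
  have hc : covDerivAlong g F (fun y => fderiv 𝕜 F y Z) p X =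
      fderiv 𝕜 F p (christoffelBil (pullbackBil g F) p X Z) + pullbackBil g F p X Z • h p := by
    rw [covDerivAlong, fderiv_clm_apply_const hdF, hh.gauss_formula, sub_add_cancel]
  rw [hQ.fderiv_apply_along hh.differentiableAt (hdF.clm_apply (differentiableAt_const Z)),
    hc] at h1
  have h2 := hh.normal (christoffelBil (pullbackBil g F) p X Z)
  rw [hQ.metric.symm] at h2
  simp only [map_add, map_smul, smul_eq_mul, h2, fderiv_fun_const, Pi.zero_apply,
    zero_apply] at h1
  linear_combination h1

/-- Pairing with ν removes the intrinsic curvature of the hypersurface. What remains of R, and the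
contribution of h ∧ I, both contain the induced metric as a factor, so this part of W is a pure
trace. -/
theorem weyl_normal (hQ : IsUmbilicHypersurfaceNear g F p) (hh : IsMeanCurvatureNear g F h p)
    {ν : Coord 𝕜 4} (hν : ∀ X, g (F p) (fderiv 𝕜 F p X) ν = 0) (X Y Z : Coord 𝕜 3) :
    weyl g (F p) (fderiv 𝕜 F p X) (fderiv 𝕜 F p Y) (fderiv 𝕜 F p Z) ν =
      pullbackBil g F p X Z * (g (F p) (covDerivAlong g F h p Y) ν
        - normRicciBil g (F p) (fderiv 𝕜 F p Y) ν)
      - pullbackBil g F p Y Z * (g (F p) (covDerivAlong g F h p X) ν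
        - normRicciBil g (F p) (fderiv 𝕜 F p X) ν) := by
  rw [hQ.metric.weyl_eq, hQ.riemann_tangent hh]
  simp only [map_add, map_sub, map_smul, add_apply, sub_apply, smul_apply, smul_eq_mul, hν,
    pullbackBil_apply]
  ring

/-- The pure trace just found must vanish since W is trace-free: `eq_zero_of_codazzi` with `C = 0`.
-/
theorem covDerivAlong_normal (hQ : IsUmbilicHypersurfaceNear g F p)
    (hh : IsMeanCurvatureNear g F h p) (hsd : ∀ u v w t, weylMinus g vol (F p) u v w t = 0)
    {e : Fin 3 → Coord 𝕜 3} {ν : Coord 𝕜 4}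
    (hb : IsAdaptedBasis (g (F p)) (fderiv 𝕜 F p) e ν) (X : Coord 𝕜 3) :
    g (F p) (covDerivAlong g F h p X) ν = normRicciBil g (F p) (fderiv 𝕜 F p X) ν :=
  sub_eq_zero.1 <| hb.eq_zero_of_codazzi (hQ.metric.isSelfDualWeyl_weyl hsd)
    (C := fun _ _ _ => 0) (a := fun X => g (F p) (covDerivAlong g F h p X) ν
      - normRicciBil g (F p) (fderiv 𝕜 F p X) ν) (fun _ => Finset.sum_const_zero)
    (fun X Y Z => by
      rw [hQ.weyl_normal hh hb.normal]
      simp only [pullbackBil_apply]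
      ring) X

/-- The Weyl tensor of a self-dual metric vanishes on umbilic hypersurfaces. -/
theorem weyl_eq_zero (hQ : IsUmbilicHypersurfaceNear g F p)
    (hsd : ∀ u v w t, weylMinus g vol (F p) u v w t = 0) (u v w t : Coord 𝕜 4) :
    weyl g (F p) u v w t = 0 := by
  obtain ⟨h, hh⟩ := hQ.exists_meanCurvature
  obtain ⟨e, ν, hb⟩ := hQ.exists_isAdaptedBasis
  refine hb.eq_zero_of_normal_eq_zero (hQ.metric.isSelfDualWeyl_weyl hsd) (fun X Y Z => ?_) u v w t
  rw [hQ.weyl_normal hh hb.normal, hQ.covDerivAlong_normal hh hsd hb,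
    hQ.covDerivAlong_normal hh hsd hb]
  ring

theorem covDerivAlong_meanCurvature (hQ : IsUmbilicHypersurfaceNear g F p)
    (hh : IsMeanCurvatureNear g F h p) (hsd : ∀ u v w t, weylMinus g vol (F p) u v w t = 0)
    (X : Coord 𝕜 3) :
    g (F p) (covDerivAlong g F h p X) (h p) = normRicciBil g (F p) (fderiv 𝕜 F p X) (h p) := by
  obtain ⟨e, ν, hb⟩ := hQ.exists_isAdaptedBasis
  have hp : h p = g (F p) ν (h p) • ν := by
    conv_lhs => rw [hb.sum_repr (h p)]
    simp [hh.normal]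
  rw [hp, map_smul, map_smul, hQ.covDerivAlong_normal hh hsd hb]

/-- The normalized Ricci tensor of an umbilic hypersurface of a self-dual metric. -/
theorem normRicciBil_pullbackBil (hQ : IsUmbilicHypersurfaceNear g F p)
    (hh : IsMeanCurvatureNear g F h p) (hsd : ∀ u v w t, weylMinus g vol (F p) u v w t = 0)
    (X Y : Coord 𝕜 3) :
    normRicciBil (pullbackBil g F) p X Y = normRicciBil g (F p) (fderiv 𝕜 F p X) (fderiv 𝕜 F p Y)
      + 1 / 2 * g (F p) (h p) (h p) * pullbackBil g F p X Y := by
  -- Since W = 0, the Gauss equation writes the intrinsic curvature as k ∧ I for this k. The factor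
  -- 1/2 appears because γ ∧ I is twice the curvature of constant curvature one.
  refine hQ.isMetricNear_pullbackBil.normRicciBil_eq_of_riemann_eq
    (k := (normRicciBil g (F p)).bilinearComp (fderiv 𝕜 F p) (fderiv 𝕜 F p)
      + (1 / 2 * g (F p) (h p) (h p)) • pullbackBil g F p) (fun X Y Z T => ?_) X Y
  have h1 := hQ.weyl_eq_zero hsd (fderiv 𝕜 F p X) (fderiv 𝕜 F p Y) (fderiv 𝕜 F p Z) (fderiv 𝕜 F p T)
  rw [hQ.metric.weyl_eq, hQ.riemann_tangent hh] at h1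
  simp only [map_add, map_sub, map_smul, add_apply, sub_apply, smul_apply, smul_eq_mul,
    hQ.covDerivAlong_tangent hh, pullbackBil_apply, ContinuousLinearMap.bilinearComp_apply] at h1 ⊢
  linear_combination h1

set_option maxHeartbeats 1000000 in
/-- On an umbilic hypersurface of a self-dual metric, the Cotton–York tensor restricts to that of
the induced metric. -/
theorem cotton_tangent (hQ : IsUmbilicHypersurfaceNear g F p)
    (hsd : ∀ᶠ y in 𝓝 p, ∀ u v w t, weylMinus g vol (F y) u v w t = 0) (X Y Z : Coord 𝕜 3) :
    cotton g (F p) (fderiv 𝕜 F p X) (fderiv 𝕜 F p Y) (fderiv 𝕜 F p Z) =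
      cotton (pullbackBil g F) p X Y Z := by
  obtain ⟨h, hh⟩ := hQ.exists_meanCurvature
  have hγ := hQ.isMetricNear_pullbackBil
  have hF := hQ.contDiffAt.differentiableAt_infty
  have hdF := hQ.contDiffAt.fderiv_infty.differentiableAt_infty
  have hk := hQ.metric.contDiffAt_normRicciBil.differentiableAt_infty
  have hg := hQ.metric.contDiffAt.differentiableAt_infty
  have dF : ∀ X, DifferentiableAt 𝕜 (fun y => fderiv 𝕜 F y X) p := fun X =>
    hdF.clm_apply (differentiableAt_const X)
  have hkF : DifferentiableAt 𝕜 (fun y => normRicciBil g (F y)) p :=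
    DifferentiableAt.comp (g := normRicciBil g) p hk hF
  have hgF : DifferentiableAt 𝕜 (fun y => g (F y)) p := DifferentiableAt.comp (g := g) p hg hF
  have hkF' : ∀ X, fderiv 𝕜 (fun y => normRicciBil g (F y)) p X =
      fderiv 𝕜 (normRicciBil g) (F p) (fderiv 𝕜 F p X) := fun X => by
    rw [show (fun y => normRicciBil g (F y)) = normRicciBil g ∘ F from rfl,
      fderiv_comp (g := normRicciBil g) p hk hF]
    rfl
  have dη : DifferentiableAt 𝕜 (fun y => g (F y) (h y) (h y)) p :=
    (hgF.clm_apply hh.differentiableAt).clm_apply hh.differentiableAt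
  have dγ : ∀ Y Z, DifferentiableAt 𝕜 (fun y => pullbackBil g F y Y Z) p := fun Y Z =>
    (hγ.contDiffAt_apply Y Z).differentiableAt_infty
  -- The formula for the induced normalized Ricci tensor, differentiated along Q. The derivative of
  -- ½ g(h,h) is g(D_X h, h), which `covDerivAlong_meanCurvature` turns into a Ricci term of M.
  have key : ∀ X Y, fderiv 𝕜 (normRicciBil (pullbackBil g F)) p X Y Z =
      (fderiv 𝕜 (normRicciBil g) (F p) (fderiv 𝕜 F p X) (fderiv 𝕜 F p Y) (fderiv 𝕜 F p Z)
        + normRicciBil g (F p) (fderiv 𝕜 (fderiv 𝕜 F) p X Y) (fderiv 𝕜 F p Z)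
        + normRicciBil g (F p) (fderiv 𝕜 F p Y) (fderiv 𝕜 (fderiv 𝕜 F) p X Z))
      + (normRicciBil g (F p) (fderiv 𝕜 F p X) (h p) * pullbackBil g F p Y Z
        + 1 / 2 * g (F p) (h p) (h p)
          * (pullbackBil g F p (christoffelBil (pullbackBil g F) p X Y) Z
            + pullbackBil g F p Y (christoffelBil (pullbackBil g F) p X Z))) := fun X Y => by
    have h1 : ∀ᶠ y in 𝓝 p, normRicciBil (pullbackBil g F) y Y Z =
        normRicciBil g (F y) (fderiv 𝕜 F y Y) (fderiv 𝕜 F y Z)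
          + 1 / 2 * g (F y) (h y) (h y) * pullbackBil g F y Y Z := by
      filter_upwards [hQ.eventually, hh.eventually, hsd] with y hQy hhy hy
      exact hQy.normRicciBil_pullbackBil hhy hy Y Z
    rw [← fderiv_clm_apply_const₂ hγ.contDiffAt_normRicciBil.differentiableAt_infty,
      fderiv_apply_eq_of_eventuallyEq h1, fderiv_add_apply'
        ((hkF.clm_apply (dF Y)).clm_apply (dF Z)) ((dη.const_mul _).fun_mul (dγ Y Z)),
      fderiv_clm_apply_apply₂ hkF (dF Y) (dF Z), fderiv_clm_apply_const hdF,
      fderiv_clm_apply_const hdF, hkF', fderiv_mul_apply' (dη.const_mul _) (dγ Y Z),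
      fderiv_clm_apply_const₂ hγ.contDiffAt.differentiableAt_infty, hγ.fderiv_apply,
      fderiv_const_mul dη, smul_apply, hQ.fderiv_apply_along hh.differentiableAt hh.differentiableAt,
      hQ.metric.symm (h p), hQ.covDerivAlong_meanCurvature hh hsd.self_of_nhds, smul_eq_mul]
    ring
  rw [hQ.metric.cotton_eq, hγ.cotton_eq, key, key]
  -- The Gauss formula contributes γ(X,Z) times the normalized Ricci tensor of M at (Y, h). After
  -- antisymmetrization in `X`, `Y` this cancels the term from the derivative of ½ g(h,h).
  simp only [hh.gauss_formula, hQ.normRicciBil_pullbackBil hh hsd.self_of_nhds]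
  rw [hγ.christoffelBil_comm Y X, hQ.metric.christoffelBil_comm (fderiv 𝕜 F p Y) (fderiv 𝕜 F p X),
    hγ.symm Y X, hγ.symm (christoffelBil (pullbackBil g F) p X Y)]
  simp only [map_add, map_sub, map_smul, add_apply, sub_apply, smul_apply, smul_eq_mul]
  ring

/-- W vanishes at every point F(y) near F(p), so the chain rule applies to a function that is zero
along the hypersurface. -/
theorem fderiv_weyl_tangent (hQ : IsUmbilicHypersurfaceNear g F p)
    (hsd : ∀ᶠ y in 𝓝 p, ∀ u v w t, weylMinus g vol (F y) u v w t = 0) (X : Coord 𝕜 3)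
    (u v w t : Coord 𝕜 4) :
    fderiv 𝕜 (fun y => weyl g y u v w t) (F p) (fderiv 𝕜 F p X) = 0 := by
  have h1 : ∀ᶠ y in 𝓝 p, weyl g (F y) u v w t = 0 := by
    filter_upwards [hQ.eventually, hsd] with y hy hy' using hy.weyl_eq_zero hy' u v w t
  have h2 := fderiv_apply_eq_of_eventuallyEq (𝕜 := 𝕜) h1 X
  have h3 := fderiv_comp (g := fun y => weyl g y u v w t) p
    (hQ.metric.contDiffAt_weyl u v w t).differentiableAt_infty hQ.contDiffAt.differentiableAt_infty
  rw [show (fun y => weyl g (F y) u v w t) = (fun y => weyl g y u v w t) ∘ F from rfl, h3] at h2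
  simpa using h2

/-- The normal derivative of the Weyl tensor at an umbilic hypersurface of a self-dual metric. -/
theorem fderiv_weyl_normal (hQ : IsUmbilicHypersurfaceNear g F p)
    (hvol : ContDiffAt 𝕜 ∞ vol (F p))
    (hsd : ∀ᶠ y in 𝓝 (F p), ∀ u v w t, weylMinus g vol y u v w t = 0)
    {ν : Coord 𝕜 4} (hν : ∀ X, g (F p) (fderiv 𝕜 F p X) ν = 0) (h1 : g (F p) ν ν = 1)
    (X Y : Coord 𝕜 3) {Z T S : Coord 𝕜 3}
    (hS : ∀ U, pullbackBil g F p S U =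
      vol (F p) ![fderiv 𝕜 F p Z, fderiv 𝕜 F p T, fderiv 𝕜 F p U, ν]) :
    fderiv 𝕜 (fun y => weyl g y (fderiv 𝕜 F p X) (fderiv 𝕜 F p Y) (fderiv 𝕜 F p Z)
      (fderiv 𝕜 F p T)) (F p) ν = - cotton (pullbackBil g F) p X Y S := by
  obtain ⟨e, hb⟩ := hQ.exists_isAdaptedBasis_of_normal hν h1
  have hsdF : ∀ᶠ y in 𝓝 p, ∀ u v w t, weylMinus g vol (F y) u v w t = 0 :=
    hQ.contDiffAt.continuousAt.eventually hsd
  have h0 := hQ.weyl_eq_zero hsdF.self_of_nhds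
  have hB := hQ.metric.weyl_bianchi h0
  have hD := hQ.metric.isSelfDualWeyl_fderiv_weyl hvol hsd h0 ν
  have htan := hQ.fderiv_weyl_tangent hsdF
  have hν' : ∀ X, g (F p) ν (fderiv 𝕜 F p X) = 0 := fun X => by rw [hQ.metric.symm, hν]
  -- With all arguments tangent, the derivatives of W in the Bianchi identity are zero, which leaves
  -- an algebraic identity for the Cotton-York tensor.
  have htr := hb.trace_eq_zero_of_bianchi
    (C := fun X Y Z => cotton g (F p) (fderiv 𝕜 F p X) (fderiv 𝕜 F p Y) (fderiv 𝕜 F p Z))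
    (fun X Y Z => hQ.metric.cotton_antisymm _ _ _)
    (fun X Z => by
      simp only [hQ.metric.cotton_eq]
      constructor <;> intros <;>
        simp only [map_add, map_smul, add_apply, smul_apply, smul_eq_mul] <;> ring)
    (fun m u v w t => by
      have := hB (fderiv 𝕜 F p m) (fderiv 𝕜 F p u) (fderiv 𝕜 F p v) (fderiv 𝕜 F p w)
        (fderiv 𝕜 F p t)
      rw [htan, htan, htan] at this
      linear_combination this)
  -- The Bianchi identity for ν, X, Y with last arguments Z, ν: two of the three derivatives are
  -- tangential and vanish. The trace part has a(Y) = -C(ν, Y, ν).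
  have hform : ∀ X Y Z, fderiv 𝕜 (fun y => weyl g y (fderiv 𝕜 F p X) (fderiv 𝕜 F p Y)
      (fderiv 𝕜 F p Z) ν) (F p) ν =
      - cotton g (F p) (fderiv 𝕜 F p X) (fderiv 𝕜 F p Y) (fderiv 𝕜 F p Z)
      + g (F p) (fderiv 𝕜 F p X) (fderiv 𝕜 F p Z) * (- cotton g (F p) ν (fderiv 𝕜 F p Y) ν)
      - g (F p) (fderiv 𝕜 F p Y) (fderiv 𝕜 F p Z) * (- cotton g (F p) ν (fderiv 𝕜 F p X) ν) :=
    fun X Y Z => by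
      have := hB ν (fderiv 𝕜 F p X) (fderiv 𝕜 F p Y) (fderiv 𝕜 F p Z) ν
      rw [htan, htan, hν, hν, hν', h1, hQ.metric.cotton_antisymm (fderiv 𝕜 F p Y) ν ν] at this
      linear_combination this
  have hb0 := hb.eq_zero_of_codazzi hD htr hform
  rw [hb.apply_eq_of_hodgeStar hD X Y hS, hform, hb0, hb0, hQ.cotton_tangent hsdF]
  ring

end IsUmbilicHypersurfaceNear

end UmbilicTheorem

/-! ### Curvature quantities depend only on the germ of the metric. -/

section Germs

variable {𝕜 : Type*} [RCLike 𝕜] {n : ℕ} {g g' : Coord 𝕜 n → Bil 𝕜 (Coord 𝕜 n)} {x : Coord 𝕜 n}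

theorem christoffel_congr (h : ∀ᶠ y in 𝓝 x, g y = g' y) : christoffel g x = christoffel g' x := by
  funext u v
  simp only [christoffel, Filter.EventuallyEq.fderiv_eq h, h.self_of_nhds]

theorem riemann_congr (h : ∀ᶠ y in 𝓝 x, g y = g' y) : riemann g x = riemann g' x := by
  have hΓ : ∀ᶠ y in 𝓝 x, christoffel g y = christoffel g' y :=
    h.eventually_nhds.mono fun y hy => christoffel_congr hy
  have hd : ∀ u v, fderiv 𝕜 (fun y => christoffel g y u v) x =
      fderiv 𝕜 (fun y => christoffel g' y u v) x := fun u v =>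
    Filter.EventuallyEq.fderiv_eq (hΓ.mono fun y hy => congrFun (congrFun hy u) v)
  funext u v w
  simp only [riemann, hd, hΓ.self_of_nhds]

theorem normRicci_congr (h : ∀ᶠ y in 𝓝 x, g y = g' y) : normRicci g x = normRicci g' x := by
  have hr : ricci g x = ricci g' x := by
    funext u v
    simp only [ricci, riemann_congr h]
  funext u v
  simp only [normRicci, scal, hr, h.self_of_nhds]

theorem cotton_congr (h : ∀ᶠ y in 𝓝 x, g y = g' y) : cotton g x = cotton g' x := by
  have hd : ∀ u v, fderiv 𝕜 (fun y => normRicci g y u v) x =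
      fderiv 𝕜 (fun y => normRicci g' y u v) x := fun u v =>
    Filter.EventuallyEq.fderiv_eq
      (h.eventually_nhds.mono fun y hy => congrFun (congrFun (normRicci_congr hy) u) v)
  funext u v w
  simp only [cotton, hd, normRicci_congr h, christoffel_congr h]

end Germs

/-! ### Tensors and vectors in a chart of a manifold. -/

section Charts

variable {𝕜 : Type*} [RCLike 𝕜] {n : ℕ} {M : Type*} [TopologicalSpace M]
  [ChartedSpace (Coord 𝕜 n) M] {φ : OpenPartialHomeomorph M (Coord 𝕜 n)}

/-- The tangent vector with given components in a chart. -/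
noncomputable def vecOfChart (φ : OpenPartialHomeomorph M (Coord 𝕜 n)) (x : M) (v : Coord 𝕜 n) :
    TangentSpace 𝓘(𝕜, Coord 𝕜 n) x :=
  mfderiv 𝓘(𝕜, Coord 𝕜 n) 𝓘(𝕜, Coord 𝕜 n) (φ.symm : Coord 𝕜 n → M) (φ x) v

theorem bilInChart_apply (g : ∀ x : M, TBil 𝕜 n x) {x : M} (hx : x ∈ φ.source)
    (u v : Coord 𝕜 n) :
    bilInChart φ g (φ x) u v = g x (vecOfChart φ x u) (vecOfChart φ x v) := by
  -- All tangent spaces are the coordinate space by definition, so both sides are compared as forms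
  -- on it. The point `φ.symm (φ x)` is generalized to `y` so that the equality with `x` can be
  -- eliminated.
  have h : ∀ y, y = x → ∀ a b : Coord 𝕜 n, (g y : Bil 𝕜 (Coord 𝕜 n)) a b =
      (g x : Bil 𝕜 (Coord 𝕜 n)) a b := by
    rintro y rfl a b
    rfl
  exact h _ (φ.left_inv hx) _ _

variable [IsManifold 𝓘(𝕜, Coord 𝕜 n) ∞ M]

theorem mdifferentiable_of_mem_atlas_coord (hφ : φ ∈ atlas (Coord 𝕜 n) M) :
    φ.MDifferentiable 𝓘(𝕜, Coord 𝕜 n) 𝓘(𝕜, Coord 𝕜 n) := by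
  have : IsManifold 𝓘(𝕜, Coord 𝕜 n) 1 M := IsManifold.of_le (n := ∞) (by simp)
  exact mdifferentiable_of_mem_atlas hφ

theorem vecInChart_vecOfChart (hφ : φ ∈ atlas (Coord 𝕜 n) M) {x : M} (hx : x ∈ φ.source)
    (v : Coord 𝕜 n) : vecInChart φ x (vecOfChart φ x v) = v := by
  have h := (mdifferentiable_of_mem_atlas_coord hφ).comp_symm_deriv (φ.map_source hx)
  rw [φ.left_inv hx] at h
  exact congrArg (fun L : Coord 𝕜 n →L[𝕜] Coord 𝕜 n => L v) h

theorem vecOfChart_vecInChart (hφ : φ ∈ atlas (Coord 𝕜 n) M) {x : M} (hx : x ∈ φ.source)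
    (v : TangentSpace 𝓘(𝕜, Coord 𝕜 n) x) : vecOfChart φ x (vecInChart φ x v) = v := by
  have h := (mdifferentiable_of_mem_atlas_coord hφ).symm_comp_deriv hx
  exact congrArg (fun L : Coord 𝕜 n →L[𝕜] Coord 𝕜 n => L v) h

theorem bilInChart_vecInChart (hφ : φ ∈ atlas (Coord 𝕜 n) M) (g : ∀ x : M, TBil 𝕜 n x) {x : M}
    (hx : x ∈ φ.source) (u v : TangentSpace 𝓘(𝕜, Coord 𝕜 n) x) :
    bilInChart φ g (φ x) (vecInChart φ x u) (vecInChart φ x v) = g x u v := by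
  rw [bilInChart_apply g hx, vecOfChart_vecInChart hφ hx, vecOfChart_vecInChart hφ hx]

theorem volInChart_vecInChart (hφ : φ ∈ atlas (Coord 𝕜 n) M) (vol : ∀ x : M, TVol 𝕜 n x) {x : M}
    (hx : x ∈ φ.source) (u v w t : TangentSpace 𝓘(𝕜, Coord 𝕜 n) x) :
    volInChart φ vol (φ x) ![vecInChart φ x u, vecInChart φ x v, vecInChart φ x w,
      vecInChart φ x t] = vol x ![u, v, w, t] := by
  have h : ∀ y, y = x → ∀ a : Fin 4 → Coord 𝕜 n, (vol y : Coord 𝕜 n [⋀^Fin 4]→L[𝕜] 𝕜) a =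
      (vol x : Coord 𝕜 n [⋀^Fin 4]→L[𝕜] 𝕜) a := by
    rintro y rfl a
    rfl
  refine (h _ (φ.left_inv hx) _).trans (congrArg (vol x) ?_)
  funext i
  have := vecOfChart_vecInChart hφ hx
  fin_cases i
  · exact this u
  · exact this v
  · exact this w
  · exact this t

theorem isMetricNear_bilInChart (hφ : φ ∈ atlas (Coord 𝕜 n) M) {U : Set M} (hU : IsOpen U)
    {g : ∀ x : M, TBil 𝕜 n x} (hg : IsMetricOn U g) {x : M} (hx : x ∈ φ.source ∩ U) :
    IsMetricNear (bilInChart φ g) (φ x) := by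
  have ho : IsOpen (φ.target ∩ φ.symm ⁻¹' U) := φ.isOpen_inter_preimage_symm hU
  have hmem : φ x ∈ φ.target ∩ φ.symm ⁻¹' U :=
    ⟨φ.map_source hx.1, by simpa [φ.left_inv hx.1] using hx.2⟩
  filter_upwards [ho.mem_nhds hmem] with z hz
  have hs : φ.symm z ∈ φ.source := φ.map_target hz.1
  obtain ⟨b, hb⟩ := hg.exists_orthonormal _ hz.2
  refine ⟨(hg.smooth φ hφ).contDiffAt (ho.mem_nhds hz), fun u v => hg.symm _ hz.2 _ _,
    fun i => vecInChart φ (φ.symm z) (b i), fun i j => ?_⟩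
  have := bilInChart_vecInChart hφ g hs (b i) (b j)
  rw [φ.right_inv hz.1] at this
  rw [this, hb]

end Charts

/-! ### Properties near a point of a map read in charts. -/

section ChartMaps

variable {E E' M Q : Type*} [TopologicalSpace E] [TopologicalSpace E'] [TopologicalSpace M]
  [TopologicalSpace Q] {φ : OpenPartialHomeomorph M E'} {ψ : OpenPartialHomeomorph Q E}
  {ι : Q → M} {U : Set M} {q : Q}

/-- A property that holds at the points of a chart domain of `Q` that are mapped to an open subset of
a chart domain of `M` holds near each of these points. -/
theorem eventually_chart (hι : Continuous ι) (hU : IsOpen U) (hq : q ∈ ψ.source)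
    (hx : ι q ∈ φ.source ∩ U) {P : E → Prop}
    (hP : ∀ q' ∈ ψ.source, ι q' ∈ φ.source ∩ U → P (ψ q')) : ∀ᶠ y in 𝓝 (ψ q), P y := by
  have ho : IsOpen (ψ.target ∩ ψ.symm ⁻¹' (ι ⁻¹' (φ.source ∩ U))) :=
    ψ.isOpen_inter_preimage_symm ((φ.open_source.inter hU).preimage hι)
  have hmem : ψ q ∈ ψ.target ∩ ψ.symm ⁻¹' (ι ⁻¹' (φ.source ∩ U)) :=
    ⟨ψ.map_source hq, by simpa [ψ.left_inv hq] using hx⟩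
  filter_upwards [ho.mem_nhds hmem] with y hy
  have := hP (ψ.symm y) (ψ.map_target hy.1) hy.2
  rwa [ψ.right_inv hy.1] at this

theorem chartMap_apply (φ : OpenPartialHomeomorph M E') (ι : Q → M) (hq : q ∈ ψ.source) :
    (φ ∘ ι ∘ ψ.symm) (ψ q) = φ (ι q) := by
  rw [Function.comp_apply, Function.comp_apply, ψ.left_inv hq]

end ChartMaps

/-! ### The hypersurface in charts, and the theorem. -/

section HypersurfaceCharts

variable {𝕜 : Type*} [RCLike 𝕜]
  {M : Type*} [TopologicalSpace M] [ChartedSpace (Coord 𝕜 4) M]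
  [IsManifold 𝓘(𝕜, Coord 𝕜 4) ∞ M]
  {Q : Type*} [TopologicalSpace Q] [ChartedSpace (Coord 𝕜 3) Q]
  [IsManifold 𝓘(𝕜, Coord 𝕜 3) ∞ Q]
  {φ : OpenPartialHomeomorph M (Coord 𝕜 4)} {ψ : OpenPartialHomeomorph Q (Coord 𝕜 3)} {ι : Q → M}
  {c : OrientedConformalStructure 𝕜 M} {U : Set M} {g : ∀ x : M, TBil 𝕜 4 x}
  {vol : ∀ x : M, TVol 𝕜 4 x} {q : Q}

theorem contDiffAt_chartMap (hφ : φ ∈ atlas (Coord 𝕜 4) M) (hψ : ψ ∈ atlas (Coord 𝕜 3) Q)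
    (hι : ContMDiff 𝓘(𝕜, Coord 𝕜 3) 𝓘(𝕜, Coord 𝕜 4) ∞ ι) (hq : q ∈ ψ.source)
    (hx : ι q ∈ φ.source) : ContDiffAt 𝕜 ∞ (φ ∘ ι ∘ ψ.symm) (ψ q) := by
  rw [← contMDiffAt_iff_contDiffAt]
  have h1 := contMDiffAt_symm_of_mem_maximalAtlas (I := 𝓘(𝕜, Coord 𝕜 3)) (n := ∞)
    (IsManifold.subset_maximalAtlas hψ) (ψ.map_source hq)
  have h2 : ContMDiffAt 𝓘(𝕜, Coord 𝕜 4) 𝓘(𝕜, Coord 𝕜 4) ∞ φ (ι (ψ.symm (ψ q))) := by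
    rw [ψ.left_inv hq]
    exact contMDiffAt_of_mem_maximalAtlas (IsManifold.subset_maximalAtlas hφ) hx
  exact ContMDiffAt.comp (ψ q) h2 (ContMDiffAt.comp (ψ q) (hι _) h1)

theorem fderiv_chartMap (hφ : φ ∈ atlas (Coord 𝕜 4) M) (hψ : ψ ∈ atlas (Coord 𝕜 3) Q)
    (hι : ContMDiff 𝓘(𝕜, Coord 𝕜 3) 𝓘(𝕜, Coord 𝕜 4) ∞ ι) (hq : q ∈ ψ.source)
    (hx : ι q ∈ φ.source) (X : Coord 𝕜 3) : fderiv 𝕜 (φ ∘ ι ∘ ψ.symm) (ψ q) X =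
      vecInChart φ (ι q) (push ι q (vecOfChart ψ q X)) := by
  have key : ∀ y, y ∈ ψ.target → ∀ q, ψ.symm y = q → ι q ∈ φ.source →
      fderiv 𝕜 (φ ∘ ι ∘ ψ.symm) y X = vecInChart φ (ι q) (push ι q
        (mfderiv 𝓘(𝕜, Coord 𝕜 3) 𝓘(𝕜, Coord 𝕜 3) (ψ.symm : Coord 𝕜 3 → Q) y X)) := by
    rintro y hy _ rfl hx
    have d1 := (mdifferentiable_of_mem_atlas_coord hψ).mdifferentiableAt_symm hy
    have d2 := (hι (ψ.symm y)).mdifferentiableAt (by simp)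
    have d3 := (mdifferentiable_of_mem_atlas_coord hφ).mdifferentiableAt hx
    rw [← mfderiv_eq_fderiv, mfderiv_comp y d3 (d2.comp y d1), mfderiv_comp y d2 d1]
    rfl
  exact key _ (ψ.map_source hq) q (ψ.left_inv hq) hx

theorem vecInChart_push (hφ : φ ∈ atlas (Coord 𝕜 4) M) (hψ : ψ ∈ atlas (Coord 𝕜 3) Q)
    (hι : ContMDiff 𝓘(𝕜, Coord 𝕜 3) 𝓘(𝕜, Coord 𝕜 4) ∞ ι) (hq : q ∈ ψ.source)
    (hx : ι q ∈ φ.source) (X : TangentSpace 𝓘(𝕜, Coord 𝕜 3) q) :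
    vecInChart φ (ι q) (push ι q X) = fderiv 𝕜 (φ ∘ ι ∘ ψ.symm) (ψ q) (vecInChart ψ q X) := by
  rw [fderiv_chartMap hφ hψ hι hq hx, vecOfChart_vecInChart hψ hq]

theorem pullbackBil_vecInChart (hφ : φ ∈ atlas (Coord 𝕜 4) M) (hψ : ψ ∈ atlas (Coord 𝕜 3) Q)
    (hι : ContMDiff 𝓘(𝕜, Coord 𝕜 3) 𝓘(𝕜, Coord 𝕜 4) ∞ ι) (hq : q ∈ ψ.source)
    (hx : ι q ∈ φ.source) (X Y : TangentSpace 𝓘(𝕜, Coord 𝕜 3) q) :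
    pullbackBil (bilInChart φ g) (φ ∘ ι ∘ ψ.symm) (ψ q) (vecInChart ψ q X) (vecInChart ψ q Y) =
      pullback ι g q X Y := by
  rw [pullbackBil_apply, ← vecInChart_push hφ hψ hι hq hx, ← vecInChart_push hφ hψ hι hq hx,
    Function.comp_apply, Function.comp_apply, ψ.left_inv hq, bilInChart_vecInChart hφ g hx]
  rfl

theorem bilInChart_pullback (hφ : φ ∈ atlas (Coord 𝕜 4) M) (hψ : ψ ∈ atlas (Coord 𝕜 3) Q)
    (hι : ContMDiff 𝓘(𝕜, Coord 𝕜 3) 𝓘(𝕜, Coord 𝕜 4) ∞ ι) (hq : q ∈ ψ.source)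
    (hx : ι q ∈ φ.source) : bilInChart ψ (pullback ι g) (ψ q) =
      pullbackBil (bilInChart φ g) (φ ∘ ι ∘ ψ.symm) (ψ q) := by
  ext X Y
  rw [bilInChart_apply _ hq, ← pullbackBil_vecInChart hφ hψ hι hq hx,
    vecInChart_vecOfChart hψ hq, vecInChart_vecOfChart hψ hq]

theorem isUmbilicHypersurfaceNear_chartMap (hφ : φ ∈ atlas (Coord 𝕜 4) M)
    (hψ : ψ ∈ atlas (Coord 𝕜 3) Q) (hι : IsNondegenerateHypersurface c ι) (humb : IsUmbilic c ι)
    (hg : IsLocalMetric c U g vol) (hq : q ∈ ψ.source) (hx : ι q ∈ φ.source ∩ U) :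
    IsUmbilicHypersurfaceNear (bilInChart φ g) (φ ∘ ι ∘ ψ.symm) (ψ q) where
  metric := by
    rw [chartMap_apply φ ι hq]
    exact isMetricNear_bilInChart hφ hg.isOpen hg.metric hx
  smooth := eventually_chart hι.smooth.continuous hg.isOpen hq hx fun q' hq' hx' =>
    contDiffAt_chartMap hφ hψ hι.smooth hq' hx'.1
  nondegenerate := eventually_chart hι.smooth.continuous hg.isOpen hq hx fun q' hq' hx' X hX => by
    have h0 := hι.nondegenerate U g vol hg q' hx'.2 (vecOfChart ψ q' X) fun Y => by
      rw [← pullbackBil_vecInChart hφ hψ hι.smooth hq' hx'.1, vecInChart_vecOfChart hψ hq', hX]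
    rw [← vecInChart_vecOfChart hψ hq' X, h0]
    exact map_zero (mfderiv 𝓘(𝕜, Coord 𝕜 3) 𝓘(𝕜, Coord 𝕜 3) ψ q')
  umbilic := eventually_chart hι.smooth.continuous hg.isOpen hq hx fun q' hq' hx' ν hν => by
    obtain ⟨H, hH⟩ := humb U g vol hg φ hφ ψ hψ q' hq' hx' (vecOfChart φ (ι q') ν) fun Z => by
      rw [← bilInChart_vecInChart hφ g hx'.1, vecInChart_vecOfChart hφ hx'.1,
        vecInChart_push hφ hψ hι.smooth hq' hx'.1, ← chartMap_apply φ ι hq', hν]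
    refine ⟨H, fun X Y => ?_⟩
    have := hH (vecOfChart ψ q' X) (vecOfChart ψ q' Y)
    rwa [← pullbackBil_vecInChart hφ hψ hι.smooth hq' hx'.1, vecInChart_vecOfChart hψ hq',
      vecInChart_vecOfChart hψ hq', vecInChart_vecOfChart hφ hx'.1] at this

theorem eventually_weylMinus_eq_zero (hφ : φ ∈ atlas (Coord 𝕜 4) M) (hc : IsSelfDual c)
    (hg : IsLocalMetric c U g vol) {x : M} (hx : x ∈ φ.source ∩ U) :
    ∀ᶠ z in 𝓝 (φ x), ∀ u v w t, weylMinus (bilInChart φ g) (volInChart φ vol) z u v w t = 0 := by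
  have ho : IsOpen (φ.target ∩ φ.symm ⁻¹' U) := φ.isOpen_inter_preimage_symm hg.isOpen
  have hmem : φ x ∈ φ.target ∩ φ.symm ⁻¹' U :=
    ⟨φ.map_source hx.1, by simpa [φ.left_inv hx.1] using hx.2⟩
  filter_upwards [ho.mem_nhds hmem] with z hz u v w t
  have hs : φ.symm z ∈ φ.source := φ.map_target hz.1
  have := hc U g vol hg φ hφ (φ.symm z) ⟨hs, hz.2⟩ (vecOfChart φ _ u) (vecOfChart φ _ v)
    (vecOfChart φ _ w) (vecOfChart φ _ t)
  rwa [weylMinusAt, vecInChart_vecOfChart hφ hs, vecInChart_vecOfChart hφ hs,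
    vecInChart_vecOfChart hφ hs, vecInChart_vecOfChart hφ hs, φ.right_inv hz.1] at this

end HypersurfaceCharts

theorem theorem5 {𝕜 : Type*} [RCLike 𝕜]
    {M : Type*} [TopologicalSpace M] [ChartedSpace (Coord 𝕜 4) M]
    [IsManifold 𝓘(𝕜, Coord 𝕜 4) ∞ M]
    {Q : Type*} [TopologicalSpace Q] [ChartedSpace (Coord 𝕜 3) Q]
    [IsManifold 𝓘(𝕜, Coord 𝕜 3) ∞ Q]
    (c : OrientedConformalStructure 𝕜 M) (hc : IsSelfDual c)
    (ι : Q → M) (hι : IsNondegenerateHypersurface c ι) (humb : IsUmbilic c ι) :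
    ∀ (U : Set M) (g : ∀ x : M, TBil 𝕜 4 x) (vol : ∀ x : M, TVol 𝕜 4 x), IsLocalMetric c U g vol →
    ∀ φ ∈ atlas (Coord 𝕜 4) M, ∀ ψ ∈ atlas (Coord 𝕜 3) Q,
    ∀ q ∈ ψ.source, ι q ∈ φ.source ∩ U →
      (∀ u v w t : TangentSpace 𝓘(𝕜, Coord 𝕜 4) (ι q), weylAt φ g (ι q) u v w t = 0) ∧
      (∀ ν : TangentSpace 𝓘(𝕜, Coord 𝕜 4) (ι q),
        (∀ X : TangentSpace 𝓘(𝕜, Coord 𝕜 3) q, g (ι q) (push ι q X) ν = 0) →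
        g (ι q) ν ν = 1 →
        ∀ X Y Z T S : TangentSpace 𝓘(𝕜, Coord 𝕜 3) q, IsHodgeStar ι g vol q ν Z T S →
          nablaWeylPlusAt φ g vol (ι q) ν (push ι q X) (push ι q Y) (push ι q Z) (push ι q T) =
            - cottonAt ψ (pullback ι g) q X Y S) := by
  intro U g vol hg φ hφ ψ hψ q hq hx
  have hQ := isUmbilicHypersurfaceNear_chartMap hφ hψ hι humb hg hq hx
  have hF := chartMap_apply φ ι hq
  have hsd := eventually_weylMinus_eq_zero hφ hc hg hx
  have h0 : ∀ u v w t, weyl (bilInChart φ g) (φ (ι q)) u v w t = 0 := by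
    rw [← hF] at hsd ⊢
    exact hQ.weyl_eq_zero hsd.self_of_nhds
  refine ⟨fun u v w t => h0 _ _ _ _, fun ν hν h1 X Y Z T S hS => ?_⟩
  have hvol : ContDiffAt 𝕜 ∞ (volInChart φ vol) (φ (ι q)) :=
    (hg.volume.smooth φ hφ).contDiffAt ((φ.isOpen_inter_preimage_symm hg.isOpen).mem_nhds
      ⟨φ.map_source hx.1, by simpa [φ.left_inv hx.1] using hx.2⟩)
  have hpush := vecInChart_push hφ hψ hι.smooth hq hx.1
  -- The expression of the induced metric in the chart ψ agrees with the coordinate pull-back near ψ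
  -- q, where ι stays in the domain of φ; the Cotton-York tensor sees no more than this germ.
  have hcot : cotton (bilInChart ψ (pullback ι g)) (ψ q) =
      cotton (pullbackBil (bilInChart φ g) (φ ∘ ι ∘ ψ.symm)) (ψ q) :=
    cotton_congr (eventually_chart hι.smooth.continuous hg.isOpen hq hx fun q' hq' hx' =>
      bilInChart_pullback hφ hψ hι.smooth hq' hx'.1)
  rw [nablaWeylPlusAt, covDeriv_weylPlus_eq hsd h0, cottonAt, hcot, hpush, hpush, hpush, hpush]
  have hν' : ∀ V, bilInChart φ g (φ (ι q)) (fderiv 𝕜 (φ ∘ ι ∘ ψ.symm) (ψ q) V)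
      (vecInChart φ (ι q) ν) = 0 := fun V => by
    rw [fderiv_chartMap hφ hψ hι.smooth hq hx.1, bilInChart_vecInChart hφ g hx.1, hν]
  have h1' : bilInChart φ g (φ (ι q)) (vecInChart φ (ι q) ν) (vecInChart φ (ι q) ν) = 1 := by
    rw [bilInChart_vecInChart hφ g hx.1, h1]
  have hS' : ∀ V, pullbackBil (bilInChart φ g) (φ ∘ ι ∘ ψ.symm) (ψ q) (vecInChart ψ q S) V =
      volInChart φ vol (φ (ι q)) ![fderiv 𝕜 (φ ∘ ι ∘ ψ.symm) (ψ q) (vecInChart ψ q Z),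
        fderiv 𝕜 (φ ∘ ι ∘ ψ.symm) (ψ q) (vecInChart ψ q T),
        fderiv 𝕜 (φ ∘ ι ∘ ψ.symm) (ψ q) V, vecInChart φ (ι q) ν] := fun V => by
    rw [← vecInChart_vecOfChart hψ hq V, pullbackBil_vecInChart hφ hψ hι.smooth hq hx.1,
      ← hpush, ← hpush, ← hpush, volInChart_vecInChart hφ vol hx.1]
    exact hS _
  -- The base point φ (ι q) is rewritten as the value of the coordinate parametrization at ψ q, the
  -- form in which the coordinate theorem is stated.
  rw [← hF] at hvol hsd hν' h1' hS' ⊢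
  exact hQ.fderiv_weyl_normal hvol hsd hν' h1' _ _ hS'
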